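/- All links are oriented tame links in $S^3$, up to isotopy. A link diagram is positive (negative) if all its crossings are positive (negative), and a link is positive (negative) if it has a positive (negative) diagram. A minimal positive (minimal negative) diagram of a link $L$ is a positive (negative) diagram of $L$ that has the least number of crossings among all positive (negative) diagrams of $L$. A link is trivial if it has a diagram without crossings. The link quandle $Q(L)$ is the quandle generated by the arcs of a diagram of $L$ with one relation for each crossing: if $y$ is the over-arc, $x$ the incoming and $z$ the outgoing under-arc, then $z = x * y$ at a positive crossing and $z = x *^{-1} y$ at a negative crossing; up to isomorphism it does not depend on the diagram. A quandle $Q$ is bi-orderable if there is a linear order $<$ on $Q$ such that $x < y$ implies $z * x < z * y$ and $x * z < y * z$ for all $x, y, z \in Q$. Theorem. Let $L_1$ be any link and let $L_2$ be a non-trivial positive (respectively negative) link. Suppose that there is a minimal positive (respectively minimal negative) diagram $D_2$ of $L_2$ such that the generators of $Q(L_2)$ that correspond to the arcs of $D_2$ are pairwise distinct elements of $Q(L_2)$. Then for every connected sum $L$ of $L_1$ and $L_2$ (along any component of $L_1$ and any component of $L_2$) the link quandle $Q(L)$ is not bi-orderable. In particular, $Q(L_2)$ is not bi-orderable. -/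

import Mathlib

/-! ## Quandles given by generators and relations

Mathlib writes `x ◃ y` for the result of `x` acting on `y`; the right-handed product `x * y` of knot
theory is `y ◃ x`, and `x *⁻¹ y` is `y ◃⁻¹ x`. -/

open scoped Quandles

/-- Formal quandle expressions in the letters `A`. -/
inductive QuandleTerm (A : Type) : Type
  | of (a : A) : QuandleTerm A
  | act (x y : QuandleTerm A) : QuandleTerm A
  | invAct (x y : QuandleTerm A) : QuandleTerm A

/-- The congruence on quandle expressions generated by the quandle axioms and the relations `R`. -/
inductive QuandleRel {A : Type} (R : QuandleTerm A → QuandleTerm A → Prop) :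
    QuandleTerm A → QuandleTerm A → Prop
  | rel {x y} (h : R x y) : QuandleRel R x y
  | refl (x : QuandleTerm A) : QuandleRel R x x
  | symm {x y} (h : QuandleRel R x y) : QuandleRel R y x
  | trans {x y z} (h : QuandleRel R x y) (h' : QuandleRel R y z) : QuandleRel R x z
  | congr_act {x x' y y'} (h : QuandleRel R x x') (h' : QuandleRel R y y') :
      QuandleRel R (x.act y) (x'.act y')
  | congr_invAct {x x' y y'} (h : QuandleRel R x x') (h' : QuandleRel R y y') :
      QuandleRel R (x.invAct y) (x'.invAct y')
  | self_distrib (x y z : QuandleTerm A) : QuandleRel R (x.act (y.act z)) ((x.act y).act (x.act z))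
  | left_inv (x y : QuandleTerm A) : QuandleRel R (x.invAct (x.act y)) y
  | right_inv (x y : QuandleTerm A) : QuandleRel R (x.act (x.invAct y)) y
  | fix (x : QuandleTerm A) : QuandleRel R (x.act x) x

/-- The setoid of `QuandleRel R`. -/
def quandleSetoid {A : Type} (R : QuandleTerm A → QuandleTerm A → Prop) :
    Setoid (QuandleTerm A) :=
  ⟨QuandleRel R, QuandleRel.refl, QuandleRel.symm, QuandleRel.trans⟩

/-- The quandle with generators `A` and relations `R`. -/
def PresentedQuandle {A : Type} (R : QuandleTerm A → QuandleTerm A → Prop) : Type :=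
  Quotient (quandleSetoid R)

/-- The element of a presented quandle given by a generator. -/
def PresentedQuandle.of {A : Type} (R : QuandleTerm A → QuandleTerm A → Prop) (a : A) :
    PresentedQuandle R :=
  Quotient.mk (quandleSetoid R) (QuandleTerm.of a)

instance {A : Type} (R : QuandleTerm A → QuandleTerm A → Prop) : Quandle (PresentedQuandle R) where
  act := Quotient.map₂ QuandleTerm.act (fun _ _ h _ _ h' => QuandleRel.congr_act h h')
  invAct := Quotient.map₂ QuandleTerm.invAct (fun _ _ h _ _ h' => QuandleRel.congr_invAct h h')
  self_distrib := by
    rintro ⟨x⟩ ⟨y⟩ ⟨z⟩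
    exact Quotient.sound (QuandleRel.self_distrib x y z)
  left_inv := by
    rintro ⟨x⟩ ⟨y⟩
    exact Quotient.sound (QuandleRel.left_inv x y)
  right_inv := by
    rintro ⟨x⟩ ⟨y⟩
    exact Quotient.sound (QuandleRel.right_inv x y)
  fix := by
    rintro ⟨x⟩
    exact Quotient.sound (QuandleRel.fix x)

/-- A quandle is bi-orderable if it has a linear order that is preserved by all left and all right
multiplications `y ↦ z * y = y ◃ z` and `x ↦ x * z = z ◃ x`. -/
def BiOrderableQuandle (Q : Type) [Quandle Q] : Prop :=
  ∃ _ : LinearOrder Q,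
    (∀ x y z : Q, x < y → x ◃ z < y ◃ z) ∧ (∀ x y z : Q, x < y → z ◃ x < z ◃ y)

/-! ## Oriented link diagrams -/

/-- A signed Gauss code of an oriented link diagram. Each crossing `c` is passed twice: `(c, true)`
is its over-passage and `(c, false)` its under-passage. `next p` is the passage that is met after `p`
when one travels along the oriented link, so that the cycles of `next` are the components that have
crossings; `loops` is the number of components without crossings. -/
structure GaussDiagram where
  /-- the crossings -/
  X : Type
  finite : Finite X
  /-- the sign of a crossing -/
  sign : X → ℤˣ
  /-- the passage that follows a given one -/
  next : Equiv.Perm (X × Bool)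
  /-- the number of components without crossings -/
  loops : ℕ

namespace GaussDiagram

/-- The edges of the diagram: `Sum.inl p` runs from the passage `p` to the passage `next p`, and
`Sum.inr i` is a whole component without crossings. -/
abbrev Edge (D : GaussDiagram) : Type := (D.X × Bool) ⊕ Fin D.loops

/-- The edge that ends at a passage. -/
def inEdge (D : GaussDiagram) (p : D.X × Bool) : D.Edge := Sum.inl (D.next.symm p)

/-- The edge that starts at a passage. -/
def outEdge (D : GaussDiagram) (p : D.X × Bool) : D.Edge := Sum.inl p

/-- The passage on the strand that comes from the bottom left when the crossing is drawn with both
strands pointing upwards. At a positive crossing this is the over-passage. -/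
def leftPassage (D : GaussDiagram) (c : D.X) : D.X × Bool := (c, decide (D.sign c = 1))

/-- The passage on the strand that comes from the bottom right when the crossing is drawn with both
strands pointing upwards. -/
def rightPassage (D : GaussDiagram) (c : D.X) : D.X × Bool := (c, !decide (D.sign c = 1))

/-- Partial drawings of the diagram in the plane, swept from below by a horizontal line.
`D.Draws l cs` says that the part below the line can be drawn so that the crossings in it are those
in `cs` and the line meets, from left to right, the edges in the list `l`, where `true` marks an
edge that points upwards and `false` one that points downwards. The sweep passes minima, maxima and
crossings; crossings are turned so that both strands point upwards. -/
inductive Draws (D : GaussDiagram) : List (D.Edge × Bool) → List D.X → Prop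
  | empty : Draws D [] []
  | minimum (u v : List (D.Edge × Bool)) (cs : List D.X) (e : D.Edge) (b : Bool) :
      Draws D (u ++ v) cs → Draws D (u ++ (e, b) :: (e, !b) :: v) cs
  | maximum (u v : List (D.Edge × Bool)) (cs : List D.X) (e : D.Edge) (b : Bool) :
      Draws D (u ++ (e, b) :: (e, !b) :: v) cs → Draws D (u ++ v) cs
  | crossing (u v : List (D.Edge × Bool)) (cs : List D.X) (c : D.X) (hc : c ∉ cs) :
      Draws D (u ++ (D.inEdge (D.leftPassage c), true) ::
        (D.inEdge (D.rightPassage c), true) :: v) cs →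
      Draws D (u ++ (D.outEdge (D.rightPassage c), true) ::
        (D.outEdge (D.leftPassage c), true) :: v) (c :: cs)

/-- The Gauss code is that of a diagram in the plane. (The pieces of the drawing that carry the label
of an edge from `p` to `next p` are one curve from `p` to `next p` and possibly some closed curves
without crossings, which can be erased. Components without crossings can always be added.) -/
def Planar (D : GaussDiagram) : Prop := ∃ cs : List D.X, D.Draws [] cs ∧ ∀ c, c ∈ cs

/-- The arcs of the diagram, which run from one under-passage to the next one (or are whole
components without under-passages): edges that meet at an over-passage belong to the same arc. -/
def Arc (D : GaussDiagram) : Type :=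
  Quot fun e f : D.Edge => ∃ c : D.X, e = D.inEdge (c, true) ∧ f = D.outEdge (c, true)

/-- The arc that contains an edge. -/
def arc (D : GaussDiagram) (e : D.Edge) : D.Arc := Quot.mk _ e

/-- The relations of the link quandle. If at the crossing `c` the over-arc is `y`, the incoming
under-arc is `x` and the outgoing under-arc is `z`, then `z = x * y` at a positive and `z = x *⁻¹ y`
at a negative crossing. -/
inductive CrossingRel (D : GaussDiagram) : QuandleTerm D.Arc → QuandleTerm D.Arc → Prop
  | pos (c : D.X) (h : D.sign c = 1) : CrossingRel D
      (.of (D.arc (D.outEdge (c, false))))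
      (.act (.of (D.arc (D.outEdge (c, true)))) (.of (D.arc (D.inEdge (c, false)))))
  | neg (c : D.X) (h : D.sign c = -1) : CrossingRel D
      (.of (D.arc (D.outEdge (c, false))))
      (.invAct (.of (D.arc (D.outEdge (c, true)))) (.of (D.arc (D.inEdge (c, false)))))

/-- The link quandle computed from the diagram. -/
abbrev LinkQuandle (D : GaussDiagram) : Type := PresentedQuandle D.CrossingRel

/-- The generator of the link quandle that corresponds to an arc. -/
def gen (D : GaussDiagram) (a : D.Arc) : D.LinkQuandle := PresentedQuandle.of D.CrossingRel a

/-- The action on passages of a map between crossings. -/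
def onPassages {X Y : Type} (f : X → Y) (p : X × Bool) : Y × Bool := (f p.1, p.2)

/-- `D'` is `D` with the crossings renamed. -/
def Iso (D D' : GaussDiagram) : Prop :=
  ∃ f : D.X ≃ D'.X, (∀ c, D'.sign (f c) = D.sign c) ∧
    (∀ p, D'.next (onPassages f p) = onPassages f (D.next p)) ∧ D'.loops = D.loops

/-- `D'` arises from `D` when the crossings in the set `R` are erased from the Gauss code. Components
all of whose crossings are erased become components without crossings. -/
def Erases (D : GaussDiagram) (R : Set D.X) (D' : GaussDiagram) : Prop :=
  ∃ f : D'.X → D.X, Function.Injective f ∧ Set.range f = Rᶜ ∧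
    (∀ c, D.sign (f c) = D'.sign c) ∧
    (∀ p : D'.X × Bool, ∃ k : ℕ,
      (D.next ^ (k + 1)) (onPassages f p) = onPassages f (D'.next p) ∧
      ∀ j < k, ((D.next ^ (j + 1)) (onPassages f p)).1 ∈ R) ∧
    D'.loops = D.loops +
      Nat.card {s : Quotient (Equiv.Perm.SameCycle.setoid D.next) //
        ∀ p : D.X × Bool, Quotient.mk (Equiv.Perm.SameCycle.setoid D.next) p = s → p.1 ∈ R}

/-- First Reidemeister move: erase a crossing whose two passages are consecutive. -/
def R1 (D D' : GaussDiagram) : Prop :=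
  ∃ (c : D.X) (b : Bool), D.next (c, b) = (c, !b) ∧ D.Erases {c} D'

/-- Second Reidemeister move: erase two crossings of opposite signs that are consecutive both on the
strand that passes over and on the strand that passes under. -/
def R2 (D D' : GaussDiagram) : Prop :=
  ∃ c₁ c₂ : D.X, c₁ ≠ c₂ ∧ D.sign c₁ = -D.sign c₂ ∧
    D.next (c₁, true) = (c₂, true) ∧
    (D.next (c₁, false) = (c₂, false) ∨ D.next (c₂, false) = (c₁, false)) ∧
    D.Erases {c₁, c₂} D'

/-- The passages `p` and `q` are consecutive, in this order if `o = 1`, in the other one if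
`o = -1`. -/
def Consecutive (D : GaussDiagram) (o : ℤˣ) (p q : D.X × Bool) : Prop :=
  (o = 1 ∧ D.next p = q) ∨ (o = -1 ∧ D.next q = p)

open Classical in
/-- The effect of the third Reidemeister move: the two crossings on each of the three sides of the
triangle change places. Here a top strand passes over a middle strand at `tm` and over a bottom strand
at `tb`, and the middle strand passes over the bottom strand at `mb`. -/
noncomputable def flipTriangle (D : GaussDiagram) (tm tb mb : D.X) : GaussDiagram :=
  let s : Equiv.Perm (D.X × Bool) :=
    Equiv.swap (tm, true) (tb, true) * Equiv.swap (tm, false) (mb, true) *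
      Equiv.swap (tb, false) (mb, false)
  { D with next := s * D.next * s⁻¹ }

/-- Third Reidemeister move. The condition on orders and signs says that the three strands meet like
three oriented straight lines in the plane, in one of the two positions (`s = 1` or `s = -1`) of the
triangle. -/
def R3 (D D' : GaussDiagram) : Prop :=
  ∃ (tm tb mb : D.X) (s : ℤˣ), tm ≠ tb ∧ tm ≠ mb ∧ tb ≠ mb ∧
    D.Consecutive (s * D.sign tb) (tm, true) (tb, true) ∧
    D.Consecutive (s * D.sign mb) (tm, false) (mb, true) ∧
    D.Consecutive (s * (D.sign tm * D.sign tb * D.sign mb)) (tb, false) (mb, false) ∧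
    (D.flipTriangle tm tb mb).Iso D'

/-- The successor map of the disjoint union of two diagrams. -/
def sumNext (D₁ D₂ : GaussDiagram) : Equiv.Perm ((D₁.X ⊕ D₂.X) × Bool) :=
  (Equiv.sumProdDistrib D₁.X D₂.X Bool).symm.permCongr (Equiv.sumCongr D₁.next D₂.next)

open Classical in
/-- The connected sum of two diagrams: the edges `e₁` and `e₂` are cut open and the ends are joined
crosswise, according to the orientations. If one of the two edges is a component without crossings,
this component is absorbed. -/
noncomputable def connectedSum (D₁ D₂ : GaussDiagram) : D₁.Edge → D₂.Edge → GaussDiagram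
  | Sum.inl p₁, Sum.inl p₂ =>
    { X := D₁.X ⊕ D₂.X
      finite := by
        have := D₁.finite
        have := D₂.finite
        infer_instance
      sign := Sum.elim D₁.sign D₂.sign
      next := sumNext D₁ D₂ * Equiv.swap (onPassages Sum.inl p₁) (onPassages Sum.inr p₂)
      loops := D₁.loops + D₂.loops }
  | _, _ =>
    { X := D₁.X ⊕ D₂.X
      finite := by
        have := D₁.finite
        have := D₂.finite
        infer_instance
      sign := Sum.elim D₁.sign D₂.sign
      next := sumNext D₁ D₂
      loops := D₁.loops + D₂.loops - 1 }

end GaussDiagram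

/-- A (planar) oriented link diagram, given by its signed Gauss code. -/
structure LinkDiagram extends GaussDiagram where
  planar : toGaussDiagram.Planar

namespace LinkDiagram

/-- Renaming of the crossings and the Reidemeister moves between planar diagrams. -/
inductive Move (D D' : LinkDiagram) : Prop
  | iso (h : D.toGaussDiagram.Iso D'.toGaussDiagram)
  | r1 (h : D.toGaussDiagram.R1 D'.toGaussDiagram)
  | r2 (h : D.toGaussDiagram.R2 D'.toGaussDiagram)
  | r3 (h : D.toGaussDiagram.R3 D'.toGaussDiagram)

/-- The number of crossings. -/
noncomputable def crossingCount (D : LinkDiagram) : ℕ := Nat.card D.X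

/-- All crossings have the sign `ε`: the diagram is positive for `ε = 1`, negative for `ε = -1`. -/
def AllOfSign (D : LinkDiagram) (ε : ℤˣ) : Prop := ∀ c : D.X, D.sign c = ε

end LinkDiagram

/-- Oriented (tame) links up to isotopy: planar diagrams up to the equivalence relation generated by
the Reidemeister moves. -/
def Link : Type 1 := Quot LinkDiagram.Move

/-- The link that a diagram represents. -/
def LinkDiagram.link (D : LinkDiagram) : Link := Quot.mk _ D

namespace Link

/-- A link is trivial if it has a diagram without crossings. -/
def IsTrivial (L : Link) : Prop := ∃ D : LinkDiagram, D.link = L ∧ IsEmpty D.X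

/-- The link is positive for `ε = 1`, negative for `ε = -1`. -/
def IsOfSign (L : Link) (ε : ℤˣ) : Prop := ∃ D : LinkDiagram, D.link = L ∧ D.AllOfSign ε

/-- `D` is a minimal positive (`ε = 1`) or minimal negative (`ε = -1`) diagram of `L`. -/
def IsMinimalDiagramOfSign (L : Link) (ε : ℤˣ) (D : LinkDiagram) : Prop :=
  D.link = L ∧ D.AllOfSign ε ∧
    ∀ D' : LinkDiagram, D'.link = L → D'.AllOfSign ε → D.crossingCount ≤ D'.crossingCount

/-- `L` is a connected sum of `L₁` and `L₂`, along some component of `L₁` and some component of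
`L₂`. -/
def IsConnectedSum (L₁ L₂ L : Link) : Prop :=
  ∃ D₁ D₂ D : LinkDiagram, D₁.link = L₁ ∧ D₂.link = L₂ ∧ D.link = L ∧
    ∃ (e₁ : D₁.Edge) (e₂ : D₂.Edge),
      (D₁.toGaussDiagram.connectedSum D₂.toGaussDiagram e₁ e₂).Iso D.toGaussDiagram

/-- The link quandle of `L` is bi-orderable, where the link quandle is computed from any diagram
of `L`. -/
def HasBiOrderableQuandle (L : Link) : Prop :=
  ∃ D : LinkDiagram, D.link = L ∧ BiOrderableQuandle D.LinkQuandle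

end Link

/-! In a bi-ordered quandle `x * y` is larger than the smaller of `x` and `y` unless `x = y`. In a
positive diagram, consider a crossing whose outgoing under-arc `z = x * y` is as small as possible.
If `x` and `y` also occur as outgoing under-arcs, then `z ≤ x` and `z ≤ y`, hence `x = y = z`. For a
negative diagram the same is done with the incoming under-arc (`LinkDiagram.exists_kink`). The arcs
at a crossing do start and end at under-passages, because no component passes only over: with all
crossings of one sign this follows from the symmetry of linking numbers (`under_mem_of_over_mem`).
As the generators are distinct, the three arcs at the crossing coincide, and by the linking argument
again it is the only crossing on its component (`next_eq_of_arcs_eq`). Erasing it contradicts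
minimality.

For a connected sum, suppose that `Q(L)` is bi-orderable. Cut `D₂` at the edge used for the sum. The
two ends have colors in `Q(L)` that act in the same way, since the product of the actions along a
sweep line is trivial away from the cut (`act'_eq_of_cut`). A bi-orderable quandle acts faithfully
on itself, so the two colors are equal. Hence there is a homomorphism from `Q(L₂)` to `Q(L)`, with a
left inverse that collapses `D₁` to one color, and the order restricts to `Q(L₂)`
(`biOrderable_of_connectedSum`).

Both arguments use particular diagrams, so bi-orderability has to be invariant under Reidemeister
moves. This is proved with colorings, which are the homomorphisms out of the link quandle: when the
colorings of two diagrams determine each other along a fixed pairing of edges, the tautological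
colorings yield injections between the quandles (`biOrderable_iff_of_colorings`). -/

/-! ## Homomorphisms out of presented quandles -/

/-- The value of a quandle expression under an assignment of its letters. -/
def QuandleTerm.eval {A Q : Type} [Quandle Q] (f : A → Q) : QuandleTerm A → Q
  | .of a => f a
  | .act x y => x.eval f ◃ y.eval f
  | .invAct x y => x.eval f ◃⁻¹ y.eval f

theorem QuandleRel.eval_eq {A Q : Type} [Quandle Q] {R : QuandleTerm A → QuandleTerm A → Prop}
    {f : A → Q} (hf : ∀ x y, R x y → x.eval f = y.eval f) {x y : QuandleTerm A}
    (h : QuandleRel R x y) : x.eval f = y.eval f := by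
  induction h with
  | rel h => exact hf _ _ h
  | refl => rfl
  | symm _ ih => exact ih.symm
  | trans _ _ ih ih' => exact ih.trans ih'
  | congr_act _ _ ih ih' => simp only [QuandleTerm.eval, ih, ih']
  | congr_invAct _ _ ih ih' => simp only [QuandleTerm.eval, ih, ih']
  | self_distrib x y z => exact Shelf.self_distrib
  | left_inv x y => exact Rack.left_inv _ _
  | right_inv x y => exact Rack.right_inv _ _
  | fix x => exact Quandle.fix

/-- The homomorphism from a presented quandle that is given by an assignment of the generators. -/
def PresentedQuandle.lift {A Q : Type} [Quandle Q] {R : QuandleTerm A → QuandleTerm A → Prop}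
    (f : A → Q) (hf : ∀ x y, R x y → x.eval f = y.eval f) : PresentedQuandle R →◃ Q where
  toFun := Quotient.lift (QuandleTerm.eval f) fun _ _ h => QuandleRel.eval_eq hf h
  map_act' := by
    rintro ⟨x⟩ ⟨y⟩
    rfl

theorem ShelfHom.map_invAct {Q Q' : Type} [Quandle Q] [Quandle Q'] (φ : Q →◃ Q') (x y : Q) :
    φ (x ◃⁻¹ y) = φ x ◃⁻¹ φ y := by
  rw [← Rack.left_cancel (φ x), ← φ.map_act, Rack.right_inv, Rack.right_inv]

theorem PresentedQuandle.hom_ext {A Q : Type} [Quandle Q]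
    {R : QuandleTerm A → QuandleTerm A → Prop} {φ ψ : PresentedQuandle R →◃ Q}
    (h : ∀ a, φ (PresentedQuandle.of R a) = ψ (PresentedQuandle.of R a)) (x : PresentedQuandle R) :
    φ x = ψ x := by
  let q : QuandleTerm A → PresentedQuandle R := Quotient.mk (quandleSetoid R)
  obtain ⟨x⟩ := x
  change φ (q x) = ψ (q x)
  induction x with
  | of a => exact h a
  | act x y ihx ihy =>
    have e : q (x.act y) = q x ◃ q y := rfl
    rw [e, φ.map_act, ψ.map_act, ihx, ihy]
  | invAct x y ihx ihy =>
    have e : q (x.invAct y) = q x ◃⁻¹ q y := rfl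
    rw [e, φ.map_invAct, ψ.map_invAct, ihx, ihy]

/-! ## Signed actions -/

/-- The action of `x`, or its inverse, according to a sign. -/
def signedAct {Q : Type} [Quandle Q] (ε : ℤˣ) (x : Q) : Equiv.Perm Q :=
  Rack.act' x ^ (ε : ℤ)

section signedAct

variable {Q Q' : Type} [Quandle Q] [Quandle Q']

theorem signedAct_one (x y : Q) : signedAct 1 x y = x ◃ y := by simp [signedAct]

theorem signedAct_neg_one (x y : Q) : signedAct (-1) x y = x ◃⁻¹ y := by
  simp [signedAct, Rack.invAct_apply]

theorem signedAct_neg (ε : ℤˣ) (x : Q) : signedAct (-ε) x = (signedAct ε x)⁻¹ := by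
  simp [signedAct]

theorem signedAct_self (ε : ℤˣ) (x : Q) : signedAct ε x x = x := by
  rcases Int.units_eq_one_or ε with rfl | rfl
  · rw [signedAct_one, Quandle.fix]
  · rw [signedAct_neg_one, Quandle.fix_inv]

/-- The action of `x` and its inverse are automorphisms, so they carry the action of `y` to a
conjugate. At a crossing this is the Wirtinger relation. -/
theorem act'_signedAct (ε : ℤˣ) (x y : Q) :
    Rack.act' (signedAct ε x y) = signedAct ε x * Rack.act' y * (signedAct ε x)⁻¹ := by
  rcases Int.units_eq_one_or ε with rfl | rfl
  · rw [signedAct_one, Rack.ad_conj]; simp [signedAct]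
  · rw [signedAct_neg_one]
    have h := Rack.ad_conj x (x ◃⁻¹ y)
    rw [Rack.right_inv] at h
    rw [h]
    simp [signedAct, mul_assoc]

theorem signedAct_signedAct (ε δ : ℤˣ) (x y : Q) :
    signedAct δ (signedAct ε x y) = signedAct ε x * signedAct δ y * (signedAct ε x)⁻¹ := by
  rw [signedAct, act'_signedAct, conj_zpow]
  rfl

theorem ShelfHom.map_signedAct (φ : Q →◃ Q') (ε : ℤˣ) (x y : Q) :
    φ (signedAct ε x y) = signedAct ε (φ x) (φ y) := by
  rcases Int.units_eq_one_or ε with rfl | rfl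
  · rw [signedAct_one, signedAct_one, φ.map_act]
  · rw [signedAct_neg_one, signedAct_neg_one, φ.map_invAct]

end signedAct

/-! ## Bi-orderability -/

theorem BiOrderableQuandle.of_injective {Q Q' : Type} [Quandle Q] [Quandle Q'] (φ : Q →◃ Q')
    (hφ : Function.Injective φ) (h : BiOrderableQuandle Q') : BiOrderableQuandle Q := by
  obtain ⟨o, h₁, h₂⟩ := h
  refine ⟨LinearOrder.lift' φ hφ, fun x y z hxy => ?_, fun x y z hxy => ?_⟩
  · change φ (x ◃ z) < φ (y ◃ z)
    rw [φ.map_act, φ.map_act]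
    exact h₁ _ _ _ hxy
  · change φ (z ◃ x) < φ (z ◃ y)
    rw [φ.map_act, φ.map_act]
    exact h₂ _ _ _ hxy

/-- In a bi-orderable quandle, elements that act in the same way are equal. -/
theorem BiOrderableQuandle.eq_of_act'_eq {Q : Type} [Quandle Q] (h : BiOrderableQuandle Q) {x y : Q}
    (hxy : Rack.act' x = Rack.act' y) : x = y := by
  obtain ⟨o, h₁, -⟩ := h
  have hz : x ◃ x = y ◃ x := DFunLike.congr_fun hxy x
  rcases lt_trichotomy x y with hlt | heq | hlt
  · exact absurd hz (h₁ _ _ x hlt).ne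
  · exact heq
  · exact absurd hz (h₁ _ _ x hlt).ne'

/-! ## Colorings of diagrams -/

namespace GaussDiagram

/-- A coloring of the edges of a diagram by a quandle, subject to the relations at the crossings. -/
structure IsColoring (D : GaussDiagram) {Q : Type} [Quandle Q] (c : D.Edge → Q) : Prop where
  over_eq : ∀ k, c (D.inEdge (k, true)) = c (D.outEdge (k, true))
  under_eq : ∀ k, c (D.outEdge (k, false)) =
    signedAct (D.sign k) (c (D.outEdge (k, true))) (c (D.inEdge (k, false)))

/-- The tautological coloring by the link quandle. -/
def edgeGen (D : GaussDiagram) (e : D.Edge) : D.LinkQuandle := D.gen (D.arc e)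

theorem isColoring_edgeGen (D : GaussDiagram) : D.IsColoring D.edgeGen where
  over_eq k := congrArg D.gen (Quot.sound ⟨k, rfl, rfl⟩)
  under_eq k := by
    rcases Int.units_eq_one_or (D.sign k) with h | h
    · rw [h, signedAct_one]
      exact Quotient.sound (QuandleRel.rel (CrossingRel.pos k h))
    · rw [h, signedAct_neg_one]
      exact Quotient.sound (QuandleRel.rel (CrossingRel.neg k h))

theorem IsColoring.map {D : GaussDiagram} {Q Q' : Type} [Quandle Q] [Quandle Q'] {c : D.Edge → Q}
    (hc : D.IsColoring c) (φ : Q →◃ Q') : D.IsColoring (fun e => φ (c e)) where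
  over_eq k := congrArg φ (hc.over_eq k)
  under_eq k := by rw [hc.under_eq k, φ.map_signedAct]

/-- The universal property that lets link quandles be compared through their colorings alone. -/
theorem IsColoring.exists_hom {D : GaussDiagram} {Q : Type} [Quandle Q] {c : D.Edge → Q}
    (hc : D.IsColoring c) : ∃ φ : D.LinkQuandle →◃ Q, ∀ e, φ (D.edgeGen e) = c e := by
  refine ⟨PresentedQuandle.lift (Quot.lift c ?_) ?_, fun e => rfl⟩
  · rintro _ _ ⟨k, rfl, rfl⟩
    exact hc.over_eq k
  · rintro _ _ (⟨k, h⟩ | ⟨k, h⟩)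
    · have := hc.under_eq k
      rw [h, signedAct_one] at this
      exact this
    · have := hc.under_eq k
      rw [h, signedAct_neg_one] at this
      exact this

theorem linkQuandle_hom_ext {D : GaussDiagram} {Q : Type} [Quandle Q] {φ ψ : D.LinkQuandle →◃ Q}
    (h : ∀ e, φ (D.edgeGen e) = ψ (D.edgeGen e)) (x : D.LinkQuandle) : φ x = ψ x :=
  PresentedQuandle.hom_ext (fun a => Quot.inductionOn a h) x

/-- Transferring each tautological coloring to the other diagram gives homomorphisms `φ` and `ψ`
between the link quandles. On edges paired by `E` the composite of `φ` and then `ψ` is the identity,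
hence everywhere by the uniqueness `h₃`. So `φ` is injective and the order is pulled back along it.
-/
theorem biOrderable_of_colorings {D D' : GaussDiagram} (E : D.Edge → D'.Edge → Prop)
    (h₁ : ∀ (Q : Type) [Quandle Q] (c : D.Edge → Q), D.IsColoring c →
      ∃ c' : D'.Edge → Q, D'.IsColoring c' ∧ ∀ e e', E e e' → c e = c' e')
    (h₂ : ∀ (Q : Type) [Quandle Q] (c' : D'.Edge → Q), D'.IsColoring c' →
      ∃ c : D.Edge → Q, D.IsColoring c ∧ ∀ e e', E e e' → c e = c' e')
    (h₃ : ∀ (Q : Type) [Quandle Q] (c₁ c₂ : D'.Edge → Q), D'.IsColoring c₁ → D'.IsColoring c₂ →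
      (∀ e e', E e e' → c₁ e' = c₂ e') → c₁ = c₂)
    (h : BiOrderableQuandle D.LinkQuandle) : BiOrderableQuandle D'.LinkQuandle := by
  obtain ⟨c', hc', hE'⟩ := h₁ _ _ D.isColoring_edgeGen
  obtain ⟨c, hc, hE⟩ := h₂ _ _ D'.isColoring_edgeGen
  obtain ⟨φ, hφ⟩ := hc'.exists_hom
  obtain ⟨ψ, hψ⟩ := hc.exists_hom
  refine h.of_injective φ (Function.LeftInverse.injective (g := ψ) fun x => ?_)
  refine linkQuandle_hom_ext (φ := ψ.comp φ) (ψ := ShelfHom.id _) (fun e => ?_) x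
  refine congrFun (h₃ _ (fun e => ψ (φ (D'.edgeGen e))) D'.edgeGen
    ((D'.isColoring_edgeGen.map φ).map ψ) D'.isColoring_edgeGen fun e e' he => ?_) e
  rw [hφ, ← hE' _ _ he, hψ, hE _ _ he]

/-- If the colorings of `D` and of `D'` correspond to each other uniquely when colors are compared
along the pairs of edges in `E`, then the link quandles are both bi-orderable or both not. -/
theorem biOrderable_iff_of_colorings {D D' : GaussDiagram} (E : D.Edge → D'.Edge → Prop)
    (h₁ : ∀ (Q : Type) [Quandle Q] (c : D.Edge → Q), D.IsColoring c →
      ∃ c' : D'.Edge → Q, D'.IsColoring c' ∧ ∀ e e', E e e' → c e = c' e')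
    (h₂ : ∀ (Q : Type) [Quandle Q] (c' : D'.Edge → Q), D'.IsColoring c' →
      ∃ c : D.Edge → Q, D.IsColoring c ∧ ∀ e e', E e e' → c e = c' e')
    (h₃ : ∀ (Q : Type) [Quandle Q] (c₁ c₂ : D'.Edge → Q), D'.IsColoring c₁ → D'.IsColoring c₂ →
      (∀ e e', E e e' → c₁ e' = c₂ e') → c₁ = c₂)
    (h₄ : ∀ (Q : Type) [Quandle Q] (c₁ c₂ : D.Edge → Q), D.IsColoring c₁ → D.IsColoring c₂ →
      (∀ e e', E e e' → c₁ e = c₂ e) → c₁ = c₂) :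
    BiOrderableQuandle D.LinkQuandle ↔ BiOrderableQuandle D'.LinkQuandle := by
  refine ⟨biOrderable_of_colorings E h₁ h₂ h₃,
    biOrderable_of_colorings (fun e' e => E e e') ?_ ?_ fun Q _ c₁ c₂ hc₁ hc₂ h =>
      h₄ Q c₁ c₂ hc₁ hc₂ fun e e' he => h e' e he⟩
  · intro Q _ c' hc'
    obtain ⟨c, hc, hE⟩ := h₂ Q c' hc'
    exact ⟨c, hc, fun e e' he => (hE e' e he).symm⟩
  · intro Q _ c hc
    obtain ⟨c', hc', hE⟩ := h₁ Q c hc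
    exact ⟨c', hc', fun e e' he => (hE e' e he).symm⟩

end GaussDiagram

/-! ## Erasing crossings -/

namespace GaussDiagram

/-- The edges of `D'` are the classes of edges of `D` under the identification of the two edges at
each passage through a crossing in `R`; the crossings of `D'` are those of `D` outside `R`. -/
structure IsErasure (D D' : GaussDiagram) (R : Set D.X) (f : D'.X → D.X)
    (ρ : D.Edge → D'.Edge) : Prop where
  range_eq : Set.range f = Rᶜ
  sign_eq : ∀ k, D.sign (f k) = D'.sign k
  map_out : ∀ q, ρ (D.outEdge (onPassages f q)) = D'.outEdge q
  map_in : ∀ q, ρ (D.inEdge (onPassages f q)) = D'.inEdge q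
  map_erased : ∀ p : D.X × Bool, p.1 ∈ R → ρ (D.inEdge p) = ρ (D.outEdge p)
  surj : Function.Surjective ρ
  factor : ∀ (Q : Type) (g : D.Edge → Q),
    (∀ p : D.X × Bool, p.1 ∈ R → g (D.inEdge p) = g (D.outEdge p)) →
      ∀ e₁ e₂, ρ e₁ = ρ e₂ → g e₁ = g e₂

/-- A coloring of `D` for which the crossings in `R` are disregarded. -/
structure IsReducedColoring (D : GaussDiagram) (R : Set D.X) {Q : Type} [Quandle Q]
    (g : D.Edge → Q) : Prop where
  erased_eq : ∀ p : D.X × Bool, p.1 ∈ R → g (D.inEdge p) = g (D.outEdge p)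
  over_eq : ∀ k ∉ R, g (D.inEdge (k, true)) = g (D.outEdge (k, true))
  under_eq : ∀ k ∉ R, g (D.outEdge (k, false)) =
    signedAct (D.sign k) (g (D.outEdge (k, true))) (g (D.inEdge (k, false)))

section IsErasure

variable {D D' : GaussDiagram} {R : Set D.X} {f : D'.X → D.X} {ρ : D.Edge → D'.Edge}
  {Q : Type} [Quandle Q]

theorem IsErasure.isReducedColoring (h : IsErasure D D' R f ρ) {c : D'.Edge → Q}
    (hc : D'.IsColoring c) : D.IsReducedColoring R (c ∘ ρ) := by
  have hf : ∀ k ∉ R, ∃ k', f k' = k := fun k hk => by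
    have : k ∈ Set.range f := h.range_eq ▸ hk
    exact this
  refine ⟨fun p hp => congrArg c (h.map_erased p hp), fun k hk => ?_, fun k hk => ?_⟩
  · obtain ⟨k, rfl⟩ := hf k hk
    exact (congrArg c (h.map_in (k, true))).trans
      ((hc.over_eq k).trans (congrArg c (h.map_out (k, true))).symm)
  · obtain ⟨k, rfl⟩ := hf k hk
    have h₁ := congrArg c (h.map_out (k, true))
    have h₂ := congrArg c (h.map_out (k, false))
    have h₃ := congrArg c (h.map_in (k, false))
    simp only [onPassages] at h₁ h₂ h₃
    simp only [Function.comp_apply, h₁, h₂, h₃, h.sign_eq]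
    exact hc.under_eq k

/-- By `factor`, `g` is constant on the fibers of `ρ`, so any section of `ρ` carries it to `D'`. -/
theorem IsErasure.exists_coloring (h : IsErasure D D' R f ρ) {g : D.Edge → Q}
    (hg : D.IsReducedColoring R g) : ∃ c : D'.Edge → Q, D'.IsColoring c ∧ g = c ∘ ρ := by
  have hc : ∀ e, g (Function.surjInv h.surj (ρ e)) = g e := fun e =>
    h.factor Q g hg.erased_eq _ _ (Function.surjInv_eq h.surj _)
  have hf : ∀ k, f k ∉ R := fun k => by
    have : f k ∈ Rᶜ := h.range_eq ▸ Set.mem_range_self k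
    exact this
  refine ⟨fun e => g (Function.surjInv h.surj e), ⟨fun k => ?_, fun k => ?_⟩,
    funext fun e => (hc e).symm⟩
  · rw [← h.map_in, ← h.map_out, hc, hc]
    exact hg.over_eq _ (hf k)
  · rw [← h.map_in, ← h.map_out, ← h.map_out, hc, hc, hc, ← h.sign_eq]
    exact hg.under_eq _ (hf k)

/-- Comparison of link quandles when the colors of the edges in `M` are changed by an erasure. -/
theorem IsErasure.biOrderable_iff (h : IsErasure D D' R f ρ) (M : Set D.Edge)
    (h₁ : ∀ (Q : Type) [Quandle Q] (c : D.Edge → Q), D.IsColoring c →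
      ∃ g : D.Edge → Q, D.IsReducedColoring R g ∧ ∀ e ∉ M, c e = g e)
    (h₂ : ∀ (Q : Type) [Quandle Q] (g : D.Edge → Q), D.IsReducedColoring R g →
      ∃ c : D.Edge → Q, D.IsColoring c ∧ ∀ e ∉ M, c e = g e)
    (h₃ : ∀ (Q : Type) [Quandle Q] (g₁ g₂ : D.Edge → Q), D.IsReducedColoring R g₁ →
      D.IsReducedColoring R g₂ → (∀ e ∉ M, g₁ e = g₂ e) → g₁ = g₂)
    (h₄ : ∀ (Q : Type) [Quandle Q] (c₁ c₂ : D.Edge → Q), D.IsColoring c₁ →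
      D.IsColoring c₂ → (∀ e ∉ M, c₁ e = c₂ e) → c₁ = c₂) :
    BiOrderableQuandle D.LinkQuandle ↔ BiOrderableQuandle D'.LinkQuandle := by
  refine biOrderable_iff_of_colorings (fun e e' => e ∉ M ∧ ρ e = e') ?_ ?_ ?_ ?_
  · intro Q _ c hc
    obtain ⟨g, hg, hcg⟩ := h₁ Q c hc
    obtain ⟨c', hc', rfl⟩ := h.exists_coloring hg
    refine ⟨c', hc', ?_⟩
    rintro e _ ⟨he, rfl⟩
    exact hcg e he
  · intro Q _ c' hc'
    obtain ⟨c, hc, hcg⟩ := h₂ Q _ (h.isReducedColoring hc')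
    refine ⟨c, hc, ?_⟩
    rintro e _ ⟨he, rfl⟩
    exact hcg e he
  · intro Q _ c₁ c₂ hc₁ hc₂ h12
    have := h₃ Q _ _ (h.isReducedColoring hc₁) (h.isReducedColoring hc₂)
      fun e he => h12 e _ ⟨he, rfl⟩
    exact h.surj.injective_comp_right this
  · intro Q _ c₁ c₂ hc₁ hc₂ h12
    exact h₄ Q c₁ c₂ hc₁ hc₂ fun e he => h12 e _ ⟨he, rfl⟩

end IsErasure

/-! ### The map of edges induced by an erasure of the Gauss code -/

/-- Travelling from the surviving passage `q` to `p` one meets only erased passages. -/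
def IsLastSurvivor (D : GaussDiagram) {Y : Type} (f : Y → D.X) (R : Set D.X) (p : D.X × Bool)
    (q : Y × Bool) : Prop :=
  ∃ k : ℕ, (D.next ^ k) (onPassages f q) = p ∧
    ∀ j < k, ((D.next ^ (j + 1)) (onPassages f q)).1 ∈ R

section IsLastSurvivor

variable {D : GaussDiagram} {Y : Type} {f : Y → D.X} {R : Set D.X}

theorem isLastSurvivor_self (q : Y × Bool) : D.IsLastSurvivor f R (onPassages f q) q :=
  ⟨0, rfl, fun j hj => absurd hj (Nat.not_lt_zero j)⟩

theorem IsLastSurvivor.next {p : D.X × Bool} {q : Y × Bool} (h : D.IsLastSurvivor f R p q)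
    (hp : (D.next p).1 ∈ R) : D.IsLastSurvivor f R (D.next p) q := by
  obtain ⟨k, rfl, hk⟩ := h
  have e : D.next ((D.next ^ k) (onPassages f q)) = (D.next ^ (k + 1)) (onPassages f q) := by
    rw [pow_succ', Equiv.Perm.mul_apply]
  refine ⟨k + 1, e.symm, fun j hj => ?_⟩
  rcases Nat.lt_succ_iff_lt_or_eq.mp hj with hj | rfl
  · exact hk j hj
  · rwa [← e]

/-- Since `next` is injective, the start of the shorter path lies on the longer one; it survives,
whereas all passages after the start of the longer path are erased, so the two starts are the same.
-/
theorem IsLastSurvivor.unique (hf : Function.Injective f) (hfR : Set.range f = Rᶜ)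
    {p : D.X × Bool} {q q' : Y × Bool} (h : D.IsLastSurvivor f R p q)
    (h' : D.IsLastSurvivor f R p q') : q = q' := by
  have hR : ∀ k, f k ∉ R := fun k => by
    have : f k ∈ Rᶜ := hfR ▸ Set.mem_range_self k
    exact this
  have key : ∀ (q q' : Y × Bool) (k d : ℕ),
      (D.next ^ k) (onPassages f q) = (D.next ^ (k + d)) (onPassages f q') →
      (∀ j < k + d, ((D.next ^ (j + 1)) (onPassages f q')).1 ∈ R) → q = q' := by
    intro q q' k d e hj
    rw [pow_add, Equiv.Perm.mul_apply, EmbeddingLike.apply_eq_iff_eq] at e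
    cases d with
    | zero =>
      have e₂ : q.2 = q'.2 := congrArg (fun x : D.X × Bool => x.2) e
      exact Prod.ext (hf (congrArg Prod.fst e)) e₂
    | succ d =>
      have := hj d (by omega)
      rw [← e] at this
      exact absurd this (hR _)
  obtain ⟨k, hk, hj⟩ := h
  obtain ⟨k', hk', hj'⟩ := h'
  rcases le_total k k' with hle | hle
  · obtain ⟨d, rfl⟩ := Nat.exists_eq_add_of_le hle
    exact key q q' k d (hk.trans hk'.symm) hj'
  · obtain ⟨d, rfl⟩ := Nat.exists_eq_add_of_le hle
    exact (key q' q k' d (hk'.trans hk.symm) hj).symm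

/-- Walk from `r` to `p` and start afresh at every surviving passage. -/
theorem exists_isLastSurvivor (hfR : Set.range f = Rᶜ) {p r : D.X × Bool}
    (hr : r.1 ∉ R) (h : D.next.SameCycle r p) : ∃ q, D.IsLastSurvivor f R p q := by
  have hf : ∀ p : D.X × Bool, p.1 ∉ R → ∃ q, onPassages f q = p := fun p hp => by
    have : p.1 ∈ Set.range f := hfR ▸ hp
    obtain ⟨k, hk⟩ := this
    exact ⟨(k, p.2), Prod.ext hk rfl⟩
  have := D.finite
  obtain ⟨n, rfl⟩ := h.exists_nat_pow_eq
  clear h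
  induction n with
  | zero =>
    obtain ⟨q, rfl⟩ := hf r hr
    exact ⟨q, isLastSurvivor_self q⟩
  | succ n ih =>
    obtain ⟨q, hq⟩ := ih
    rw [pow_succ', Equiv.Perm.mul_apply]
    by_cases hR : (D.next ((D.next ^ n) r)).1 ∈ R
    · exact ⟨q, hq.next hR⟩
    · obtain ⟨q, hq⟩ := hf _ hR
      exact ⟨q, hq ▸ isLastSurvivor_self q⟩

theorem IsLastSurvivor.eq_of_erased {Q : Type} {g : D.Edge → Q}
    (hg : ∀ p : D.X × Bool, p.1 ∈ R → g (D.inEdge p) = g (D.outEdge p)) {p : D.X × Bool}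
    {q : Y × Bool} (h : D.IsLastSurvivor f R p q) :
    g (Sum.inl p) = g (Sum.inl (onPassages f q)) := by
  obtain ⟨k, rfl, hk⟩ := h
  induction k with
  | zero => rfl
  | succ k ih =>
    rw [← ih fun j hj => hk j (by omega)]
    have := hg _ (hk k (by omega))
    rw [pow_succ', Equiv.Perm.mul_apply] at this ⊢
    simpa [inEdge, outEdge] using this.symm

end IsLastSurvivor

/-- An edge is sent to the edge of `D'` that leaves the last surviving passage at or before its
start. If its whole cycle is erased, it is sent to the new crossingless component that replaces the
cycle. -/
theorem Erases.exists_isErasure {D D' : GaussDiagram} {R : Set D.X} (h : D.Erases R D') :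
    ∃ f ρ, IsErasure D D' R f ρ := by
  classical
  obtain ⟨f, hf, hfR, hsign, hnext, hloops⟩ := h
  have := D.finite
  let C := {s : Quotient (Equiv.Perm.SameCycle.setoid D.next) //
    ∀ p : D.X × Bool, Quotient.mk (Equiv.Perm.SameCycle.setoid D.next) p = s → p.1 ∈ R}
  have hC : Finite C := by
    have : Finite (Quotient (Equiv.Perm.SameCycle.setoid D.next)) := Quotient.finite _
    exact Subtype.finite
  -- Only the number of loops of `D'` is prescribed, so the erased cycles are numbered arbitrarily.
  let θ : Fin D.loops ⊕ C ≃ Fin D'.loops :=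
    ((Equiv.refl _).sumCongr (Finite.equivFin C)).trans
      (finSumFinEquiv.trans (finCongr hloops.symm))
  have hmk : ∀ p r : D.X × Bool, Quotient.mk (Equiv.Perm.SameCycle.setoid D.next) r =
      Quotient.mk (Equiv.Perm.SameCycle.setoid D.next) p ↔ D.next.SameCycle r p := fun p r =>
    ⟨fun h => Quotient.exact h, fun h => Quotient.sound h⟩
  have hex : ∀ p : D.X × Bool, ¬ (∀ r, Quotient.mk (Equiv.Perm.SameCycle.setoid D.next) r =
      Quotient.mk (Equiv.Perm.SameCycle.setoid D.next) p → r.1 ∈ R) →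
      ∃ q, D.IsLastSurvivor f R p q := by
    intro p hp
    push Not at hp
    obtain ⟨r, hr, hrR⟩ := hp
    exact exists_isLastSurvivor hfR hrR ((hmk p r).mp hr)
  let ρ : D.Edge → D'.Edge := Sum.elim
    (fun p => if hp : ∀ r, Quotient.mk (Equiv.Perm.SameCycle.setoid D.next) r =
      Quotient.mk (Equiv.Perm.SameCycle.setoid D.next) p → r.1 ∈ R
      then Sum.inr (θ (Sum.inr ⟨_, hp⟩)) else Sum.inl (hex p hp).choose)
    (fun i => Sum.inr (θ (Sum.inl i)))
  have hρ : ∀ p q, D.IsLastSurvivor f R p q → ρ (Sum.inl p) = Sum.inl q := by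
    intro p q hq
    have hp : ¬ ∀ r, Quotient.mk (Equiv.Perm.SameCycle.setoid D.next) r =
        Quotient.mk (Equiv.Perm.SameCycle.setoid D.next) p → r.1 ∈ R := by
      intro hp
      obtain ⟨k, rfl, -⟩ := hq
      have h₁ := hp (onPassages f q) ((hmk _ _).mpr ⟨k, by simp⟩)
      have h₂ : f q.1 ∈ Rᶜ := hfR ▸ Set.mem_range_self q.1
      exact h₂ h₁
    simp only [ρ, Sum.elim_inl, dif_neg hp]
    rw [IsLastSurvivor.unique hf hfR (hex p hp).choose_spec hq]
  have hρ' : ∀ p : D.X × Bool, (∃ q, D.IsLastSurvivor f R p q) ∨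
      ∃ hp, ρ (Sum.inl p) = Sum.inr (θ (Sum.inr
        ⟨Quotient.mk (Equiv.Perm.SameCycle.setoid D.next) p, hp⟩)) := by
    intro p
    by_cases hp : ∀ r, Quotient.mk (Equiv.Perm.SameCycle.setoid D.next) r =
        Quotient.mk (Equiv.Perm.SameCycle.setoid D.next) p → r.1 ∈ R
    · exact Or.inr ⟨hp, by simp only [ρ, Sum.elim_inl, dif_pos hp]⟩
    · exact Or.inl (hex p hp)
  refine ⟨f, ρ, hfR, hsign, fun q => hρ _ _ (isLastSurvivor_self q), fun q => ?_, fun p hp => ?_,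
    ?_, ?_⟩
  · obtain ⟨k, hk, hj⟩ := hnext (D'.next.symm q)
    rw [Equiv.apply_symm_apply] at hk
    refine hρ _ _ ⟨k, ?_, hj⟩
    rw [← hk, pow_succ', Equiv.Perm.mul_apply, Equiv.symm_apply_apply]
  · obtain ⟨p, rfl⟩ := D.next.surjective p
    simp only [inEdge, outEdge, Equiv.symm_apply_apply]
    rcases hρ' p with ⟨q, hq⟩ | ⟨h₁, h₂⟩
    · rw [hρ _ _ hq, hρ _ _ (hq.next hp)]
    · have e := (hmk p (D.next p)).mpr ⟨-1, by simp⟩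
      rcases hρ' (D.next p) with ⟨q, hq⟩ | ⟨h₃, h₄⟩
      · exfalso
        obtain ⟨k, hk, -⟩ := hq
        have h₅ := h₁ (onPassages f q) (((hmk _ _).mpr ⟨k, by simpa using hk⟩).trans e)
        have h₆ : f q.1 ∈ Rᶜ := hfR ▸ Set.mem_range_self q.1
        exact h₆ h₅
      · rw [h₂, h₄]
        congr 4
        exact e.symm
  · rintro (q | i)
    · exact ⟨_, hρ _ _ (isLastSurvivor_self q)⟩
    · obtain ⟨i | ⟨s, hs⟩, rfl⟩ := θ.surjective i
      · exact ⟨Sum.inr i, rfl⟩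
      · induction s using Quotient.inductionOn with
        | h p => exact ⟨Sum.inl p, by simp only [ρ, Sum.elim_inl]; rw [dif_pos hs]⟩
  · intro Q g hg
    have hcyc : ∀ p r : D.X × Bool, (∀ r, Quotient.mk (Equiv.Perm.SameCycle.setoid D.next) r =
        Quotient.mk (Equiv.Perm.SameCycle.setoid D.next) p → r.1 ∈ R) →
        D.next.SameCycle p r → g (Sum.inl r) = g (Sum.inl p) := by
      intro p r hp hr
      obtain ⟨n, rfl⟩ := hr.exists_nat_pow_eq
      clear hr
      induction n with
      | zero => rfl
      | succ n ih =>
        rw [← ih, pow_succ', Equiv.Perm.mul_apply]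
        have := hg (D.next ((D.next ^ n) p)) (hp _ ((hmk _ _).mpr
          (by simp [Equiv.Perm.SameCycle.refl])))
        simpa [inEdge, outEdge] using this.symm
    rintro (p | i) (p' | i') he
    · rcases hρ' p with ⟨q, hq⟩ | ⟨h₁, h₂⟩ <;> rcases hρ' p' with ⟨q', hq'⟩ | ⟨h₃, h₄⟩
      · rw [hρ _ _ hq, hρ _ _ hq', Sum.inl.injEq] at he
        rw [hq.eq_of_erased hg, hq'.eq_of_erased hg, he]
      · rw [hρ _ _ hq, h₄] at he
        cases he
      · rw [hρ _ _ hq', h₂] at he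
        cases he
      · rw [h₂, h₄, Sum.inr.injEq, θ.apply_eq_iff_eq, Sum.inr.injEq, Subtype.mk.injEq] at he
        exact (hcyc p p' h₁ ((hmk _ _).mp he)).symm
    · exfalso
      rcases hρ' p with ⟨q, hq⟩ | ⟨h₁, h₂⟩
      · rw [hρ _ _ hq] at he
        cases he
      · rw [h₂] at he
        simp [ρ] at he
    · exfalso
      rcases hρ' p' with ⟨q, hq⟩ | ⟨h₁, h₂⟩
      · rw [hρ _ _ hq] at he
        cases he
      · rw [h₂] at he
        simp [ρ] at he
    · simp only [ρ, Sum.elim_inr, Sum.inr.injEq, θ.apply_eq_iff_eq, Sum.inl.injEq] at he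
      rw [he]

end GaussDiagram

/-! ## Invariance of bi-orderability under renaming and the first two Reidemeister moves -/

namespace GaussDiagram

/-- A renaming is an erasure of no crossings, so the comparison for erasures applies to it. -/
theorem Iso.exists_isErasure {D D' : GaussDiagram} (h : D.Iso D') :
    ∃ f ρ, IsErasure D D' ∅ f ρ := by
  obtain ⟨f, hsign, hnext, hloops⟩ := h
  have hs : ∀ p, onPassages f.symm (onPassages f p) = p := fun p => by simp [onPassages]
  have hs' : ∀ p, onPassages f (onPassages f.symm p) = p := fun p => by simp [onPassages]
  have hnext' : ∀ q, onPassages f (D.next.symm q) = D'.next.symm (onPassages f q) := fun q => by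
    rw [Equiv.eq_symm_apply, hnext, Equiv.apply_symm_apply]
  refine ⟨f.symm, Sum.map (onPassages f) (finCongr hloops.symm), by simp, fun k => ?_, fun q => ?_,
    fun q => ?_, fun p hp => absurd hp (Set.notMem_empty _), ?_, fun Q g _ e e' he => ?_⟩
  · rw [← hsign, Equiv.apply_symm_apply]
  · simp [outEdge, hs']
  · simp [inEdge, hnext', hs']
  · rintro (q | i)
    · exact ⟨Sum.inl (onPassages f.symm q), by simp [hs']⟩
    · exact ⟨Sum.inr (finCongr hloops i), by simp⟩
  · refine congrArg g (Function.Injective.sumMap ?_ (finCongr hloops.symm).injective he)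
    exact Function.LeftInverse.injective hs

theorem isColoring_iff_isReducedColoring_empty {D : GaussDiagram} {Q : Type} [Quandle Q]
    {c : D.Edge → Q} : D.IsColoring c ↔ D.IsReducedColoring ∅ c :=
  ⟨fun h => ⟨fun _ hp => absurd hp (Set.notMem_empty _), fun k _ => h.over_eq k,
    fun k _ => h.under_eq k⟩, fun h => ⟨fun k => h.over_eq k (Set.notMem_empty k),
    fun k => h.under_eq k (Set.notMem_empty k)⟩⟩

theorem IsErasure.biOrderable_iff_of_isColoring_iff {D D' : GaussDiagram} {R : Set D.X}
    {f : D'.X → D.X} {ρ : D.Edge → D'.Edge} (h : IsErasure D D' R f ρ)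
    (hR : ∀ (Q : Type) [Quandle Q] (c : D.Edge → Q), D.IsColoring c ↔ D.IsReducedColoring R c) :
    BiOrderableQuandle D.LinkQuandle ↔ BiOrderableQuandle D'.LinkQuandle :=
  h.biOrderable_iff ∅ (fun Q _ c hc => ⟨c, (hR Q c).mp hc, fun _ _ => rfl⟩)
    (fun Q _ c hc => ⟨c, (hR Q c).mpr hc, fun _ _ => rfl⟩)
    (fun _ _ _ _ _ _ h => funext fun e => h e (Set.notMem_empty e))
    (fun _ _ _ _ _ _ h => funext fun e => h e (Set.notMem_empty e))

theorem Iso.biOrderable_iff {D D' : GaussDiagram} (h : D.Iso D') :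
    BiOrderableQuandle D.LinkQuandle ↔ BiOrderableQuandle D'.LinkQuandle := by
  obtain ⟨f, ρ, h⟩ := h.exists_isErasure
  exact h.biOrderable_iff_of_isColoring_iff fun Q _ c => isColoring_iff_isReducedColoring_empty

theorem inEdge_eq_outEdge {D : GaussDiagram} {p q : D.X × Bool} (h : D.next p = q) :
    D.inEdge q = D.outEdge p := by
  rw [← h, inEdge, outEdge, Equiv.symm_apply_apply]

/-- At a kink the strand acts on itself. By idempotency the relation there amounts to the equality
of all colors at the crossing. -/
theorem isColoring_iff_isReducedColoring_kink {D : GaussDiagram} {k : D.X} {b : Bool}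
    (hk : D.next (k, b) = (k, !b)) {Q : Type} [Quandle Q] {c : D.Edge → Q} :
    D.IsColoring c ↔ D.IsReducedColoring {k} c := by
  have hmid := inEdge_eq_outEdge hk
  constructor
  · intro h
    refine ⟨?_, fun k _ => h.over_eq k, fun k _ => h.under_eq k⟩
    rintro ⟨k', b'⟩ (rfl : k' = k)
    have h₁ := h.over_eq k'
    have h₂ := h.under_eq k'
    cases b' with
    | true => exact h₁
    | false =>
      cases b with
      | true =>
        simp only [Bool.not_true] at hmid
        rw [hmid, signedAct_self] at h₂
        rw [hmid, h₂]
      | false =>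
        simp only [Bool.not_false] at hmid
        rw [hmid] at h₁
        rw [← h₁] at h₂
        -- Here the over-arc is the outgoing arc `z`. Writing `z` as `z` acting on itself, the
        -- action of `z` cancels.
        nth_rewrite 1 [← signedAct_self (D.sign k') (c (D.outEdge (k', false)))] at h₂
        exact ((signedAct _ _).injective h₂).symm
  · intro h
    refine ⟨fun k' => ?_, fun k' => ?_⟩
    · by_cases hk' : k' ∈ ({k} : Set D.X)
      · exact h.erased_eq (k', true) hk'
      · exact h.over_eq k' hk'
    · by_cases hk' : k' ∈ ({k} : Set D.X)
      · have h₁ := h.erased_eq (k', true) hk'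
        have h₂ := h.erased_eq (k', false) hk'
        obtain rfl : k' = k := hk'
        have h₃ : c (D.outEdge (k', false)) = c (D.outEdge (k', true)) := by
          cases b with
          | true => rw [← h₂]; exact congrArg c hmid
          | false => rw [← h₁]; exact (congrArg c hmid).symm
        rw [h₂, h₃, signedAct_self]
      · exact h.under_eq k' hk'

theorem R1.biOrderable_iff {D D' : GaussDiagram} (h : D.R1 D') :
    BiOrderableQuandle D.LinkQuandle ↔ BiOrderableQuandle D'.LinkQuandle := by
  obtain ⟨k, b, hk, h⟩ := h
  obtain ⟨f, ρ, h⟩ := h.exists_isErasure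
  exact h.biOrderable_iff_of_isColoring_iff fun Q _ c => isColoring_iff_isReducedColoring_kink hk

/-- The over-strand has the same color at both crossings, and as the signs are opposite its two
actions cancel. So only the edge between the crossings on the under-strand changes color. Here `d₁`
is the crossing that the under-strand meets first. -/
theorem IsErasure.biOrderable_iff_bigon {D D' : GaussDiagram} {d₁ d₂ : D.X} {f : D'.X → D.X}
    {ρ : D.Edge → D'.Edge} (h : IsErasure D D' {d₁, d₂} f ρ) (hne : d₁ ≠ d₂)
    (hsign : D.sign d₂ = -D.sign d₁) (hunder : D.next (d₁, false) = (d₂, false))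
    (hover : D.next (d₁, true) = (d₂, true) ∨ D.next (d₂, true) = (d₁, true)) :
    BiOrderableQuandle D.LinkQuandle ↔ BiOrderableQuandle D'.LinkQuandle := by
  classical
  have hin : ∀ p : D.X × Bool, p ≠ (d₂, false) → D.inEdge p ≠ D.outEdge (d₁, false) := by
    intro p hp he
    apply hp
    rw [inEdge, outEdge, Sum.inl.injEq, Equiv.symm_apply_eq, hunder] at he
    exact he
  have hout : ∀ p : D.X × Bool, p ≠ (d₁, false) → D.outEdge p ≠ D.outEdge (d₁, false) := by
    intro p hp he
    exact hp (Sum.inl.inj he)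
  have hmid : D.inEdge (d₂, false) = D.outEdge (d₁, false) := inEdge_eq_outEdge hunder
  have htop : ∀ {Q : Type} (c : D.Edge → Q),
      c (D.inEdge (d₁, true)) = c (D.outEdge (d₁, true)) →
      c (D.inEdge (d₂, true)) = c (D.outEdge (d₂, true)) →
      c (D.outEdge (d₁, true)) = c (D.outEdge (d₂, true)) := by
    intro Q c h₁ h₂
    rcases hover with h | h
    · rw [← h₂, inEdge_eq_outEdge h]
    · rw [← h₁, inEdge_eq_outEdge h]
  have hd₁ : (d₁, false) ≠ (d₂, false) := fun h => hne (congrArg Prod.fst h)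
  refine h.biOrderable_iff {D.outEdge (d₁, false)} ?_ ?_ ?_ ?_
  · intro Q _ c hc
    have hin' : ∀ p : D.X × Bool, p ≠ (d₂, false) →
        Function.update c (D.outEdge (d₁, false)) (c (D.inEdge (d₁, false))) (D.inEdge p) =
          c (D.inEdge p) := fun p hp => Function.update_of_ne (hin p hp) _ _
    have hout' : ∀ p : D.X × Bool, p ≠ (d₁, false) →
        Function.update c (D.outEdge (d₁, false)) (c (D.inEdge (d₁, false))) (D.outEdge p) =
          c (D.outEdge p) := fun p hp => Function.update_of_ne (hout p hp) _ _
    refine ⟨Function.update c (D.outEdge (d₁, false)) (c (D.inEdge (d₁, false))), ⟨?_, ?_, ?_⟩,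
      fun e he => (Function.update_of_ne he _ _).symm⟩
    · rintro ⟨k, b⟩ hk
      cases b with
      | true => rw [hin' _ (by simp), hout' _ (by simp), hc.over_eq]
      | false =>
        rcases hk with (rfl : k = d₁) | (rfl : k = d₂)
        · rw [hin' _ hd₁, Function.update_self]
        · rw [hmid, Function.update_self, hout' _ hd₁.symm, hc.under_eq k, hmid, hc.under_eq d₁,
            hsign, ← htop c (hc.over_eq _) (hc.over_eq _), signedAct_neg]
          simp
    · intro k hk
      rw [hin' _ (by simp), hout' _ (by simp), hc.over_eq]
    · intro k hk
      simp only [Set.mem_insert_iff, Set.mem_singleton_iff, not_or] at hk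
      rw [hin' _ (by simp [hk.2]), hout' (k, true) (by simp), hout' (k, false) (by simp [hk.1]),
        hc.under_eq]
  · intro Q _ g hg
    -- The color that the relation at `d₁` forces on the edge in the middle.
    let v := signedAct (D.sign d₁) (g (D.outEdge (d₁, true))) (g (D.inEdge (d₁, false)))
    have hin' : ∀ p : D.X × Bool, p ≠ (d₂, false) →
        Function.update g (D.outEdge (d₁, false)) v (D.inEdge p) = g (D.inEdge p) :=
      fun p hp => Function.update_of_ne (hin p hp) _ _
    have hout' : ∀ p : D.X × Bool, p ≠ (d₁, false) →
        Function.update g (D.outEdge (d₁, false)) v (D.outEdge p) = g (D.outEdge p) :=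
      fun p hp => Function.update_of_ne (hout p hp) _ _
    have hm₁ : d₁ ∈ ({d₁, d₂} : Set D.X) := Or.inl rfl
    have hm₂ : d₂ ∈ ({d₁, d₂} : Set D.X) := Or.inr rfl
    refine ⟨Function.update g (D.outEdge (d₁, false)) v, ⟨fun k => ?_, fun k => ?_⟩,
      fun e he => Function.update_of_ne he _ _⟩
    · rw [hin' _ (by simp), hout' _ (by simp)]
      by_cases hk : k ∈ ({d₁, d₂} : Set D.X)
      · exact hg.erased_eq _ hk
      · exact hg.over_eq k hk
    · rw [hout' (k, true) (by simp)]
      by_cases hk : k ∈ ({d₁, d₂} : Set D.X)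
      · rcases hk with (rfl : k = d₁) | (rfl : k = d₂)
        · rw [hin' _ hd₁, Function.update_self]
        · rw [hmid, Function.update_self, hout' _ hd₁.symm, hsign,
            ← htop g (hg.erased_eq _ hm₁) (hg.erased_eq _ hm₂), signedAct_neg,
            ← hg.erased_eq (k, false) hm₂, hmid, ← hg.erased_eq (d₁, false) hm₁]
          simp [v]
      · have hk' := hk
        simp only [Set.mem_insert_iff, Set.mem_singleton_iff, not_or] at hk'
        rw [hin' _ (by simp [hk'.2]), hout' _ (by simp [hk'.1]), hg.under_eq k hk]
  · intro Q _ g₁ g₂ hg₁ hg₂ h12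
    funext e
    by_cases he : e = D.outEdge (d₁, false)
    · rw [he, ← hg₁.erased_eq _ (Or.inl rfl), ← hg₂.erased_eq _ (Or.inl rfl)]
      exact h12 _ (hin _ hd₁)
    · exact h12 e he
  · intro Q _ c₁ c₂ hc₁ hc₂ h12
    funext e
    by_cases he : e = D.outEdge (d₁, false)
    · rw [he, hc₁.under_eq, hc₂.under_eq, h12 _ (hin _ hd₁), h12 _ (hout (d₁, true) (by simp))]
    · exact h12 e he

theorem R2.biOrderable_iff {D D' : GaussDiagram} (h : D.R2 D') :
    BiOrderableQuandle D.LinkQuandle ↔ BiOrderableQuandle D'.LinkQuandle := by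
  obtain ⟨c₁, c₂, hne, hsign, hover, hunder, h⟩ := h
  obtain ⟨f, ρ, h⟩ := h.exists_isErasure
  -- `R2` numbers the crossings along the over-strand, the bigon lemma along the under-strand.
  rcases hunder with hunder | hunder
  · exact h.biOrderable_iff_bigon hne (by rw [hsign, neg_neg]) hunder (Or.inl hover)
  · rw [Set.pair_comm] at h
    exact h.biOrderable_iff_bigon hne.symm hsign hunder (Or.inr hover)

end GaussDiagram

/-! ## Invariance of bi-orderability under the third Reidemeister move -/

namespace GaussDiagram

/-- The diagram with the same crossings and signs, and another successor map. -/
abbrev withNext (D : GaussDiagram) (n : Equiv.Perm (D.X × Bool)) : GaussDiagram := { D with next := n }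

/-- The permutation of passages that exchanges the two crossings on each side of a triangle. -/
structure IsTriangleSwap {X : Type} (tm tb mb : X) (s : Equiv.Perm (X × Bool)) : Prop where
  involutive : ∀ p, s (s p) = p
  tm_true : s (tm, true) = (tb, true)
  tb_true : s (tb, true) = (tm, true)
  tm_false : s (tm, false) = (mb, true)
  mb_true : s (mb, true) = (tm, false)
  tb_false : s (tb, false) = (mb, false)
  mb_false : s (mb, false) = (tb, false)
  of_ne : ∀ k b, k ≠ tm → k ≠ tb → k ≠ mb → s (k, b) = (k, b)

/-- The edges inside the middle and the bottom strand of a triangle whose orders are `u`, `v`. -/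
def triangleMid {X : Type} (tm tb mb : X) (u v : ℤˣ) : Set (X × Bool) :=
  {if u = 1 then (tm, false) else (mb, true), if v = 1 then (tb, false) else (mb, false)}

/-- The combinatorial data of a triangle with orders `w`, `u`, `v` on its three sides. -/
structure IsTriangle (D : GaussDiagram) (tm tb mb : D.X) (w u v : ℤˣ) : Prop where
  ne₁ : tm ≠ tb
  ne₂ : tm ≠ mb
  ne₃ : tb ≠ mb
  sign_eq : v = u * (D.sign tm * D.sign tb)
  top : D.Consecutive w (tm, true) (tb, true)
  middle : D.Consecutive u (tm, false) (mb, true)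
  bottom : D.Consecutive v (tb, false) (mb, false)

section Triangle

variable {D : GaussDiagram} {tm tb mb : D.X} {w u v : ℤˣ} {s n : Equiv.Perm (D.X × Bool)}
  {Q : Type} [Quandle Q]

theorem Consecutive.flip {o : ℤˣ} {p q : D.X × Bool} (h : D.Consecutive o p q)
    (hn : ∀ p, n (s p) = s (D.next p)) (hp : s p = q) (hq : s q = p) :
    (D.withNext n).Consecutive (-o) p q := by
  rcases h with ⟨rfl, h⟩ | ⟨rfl, h⟩
  · refine Or.inr ⟨rfl, ?_⟩
    change n q = p
    rw [← hp, hn, h, hq]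
  · refine Or.inl ⟨neg_neg 1, ?_⟩
    change n p = q
    rw [← hq, hn, h, hp]

theorem IsTriangle.flip (h : D.IsTriangle tm tb mb w u v) (hs : IsTriangleSwap tm tb mb s)
    (hn : ∀ p, n (s p) = s (D.next p)) :
    (D.withNext n).IsTriangle tm tb mb (-w) (-u) (-v) where
  ne₁ := h.ne₁
  ne₂ := h.ne₂
  ne₃ := h.ne₃
  sign_eq := by rw [neg_mul]; exact congrArg Neg.neg h.sign_eq
  top := h.top.flip hn hs.tm_true hs.tb_true
  middle := h.middle.flip hn hs.tm_false hs.mb_true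
  bottom := h.bottom.flip hn hs.tb_false hs.mb_false

-- Each of the two inner edges starts at a crossing of the triangle, whose relation determines its
-- color. The inner edge of the top strand is not among them, since its color does not change.
set_option linter.unusedSimpArgs false in
theorem IsTriangle.coloring_ext (h : D.IsTriangle tm tb mb w u v) {c₁ c₂ : D.Edge → Q}
    (hc₁ : D.IsColoring c₁) (hc₂ : D.IsColoring c₂)
    (hp : ∀ p ∉ triangleMid tm tb mb u v, c₁ (Sum.inl p) = c₂ (Sum.inl p))
    (hi : ∀ i, c₁ (Sum.inr i) = c₂ (Sum.inr i)) : c₁ = c₂ := by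
  have hin : ∀ p, D.next.symm p ∉ triangleMid tm tb mb u v →
    c₁ (D.inEdge p) = c₂ (D.inEdge p) := fun p => hp _
  have hout : ∀ p, p ∉ triangleMid tm tb mb u v →
    c₁ (D.outEdge p) = c₂ (D.outEdge p) := fun p => hp p
  have h₁ := h.ne₁
  have h₂ := h.ne₂
  have h₃ := h.ne₃
  have h₁' := h.ne₁.symm
  have h₂' := h.ne₂.symm
  have h₃' := h.ne₃.symm
  -- The middle strand comes first, since its color enters the relation of the bottom strand at
  -- `mb`.
  have hmid : c₁ (D.outEdge (tm, false)) = c₂ (D.outEdge (tm, false)) ∧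
      c₁ (D.outEdge (mb, true)) = c₂ (D.outEdge (mb, true)) := by
    rcases h.middle with ⟨rfl, hu⟩ | ⟨rfl, hu⟩ <;> rcases h.bottom with ⟨rfl, hv⟩ | ⟨rfl, hv⟩ <;>
    refine ⟨?_, ?_⟩ <;>
    first
    | (apply hout; simp [triangleMid, h₁, h₂, h₃, h₁', h₂', h₃']; done)
    | (rw [hc₁.under_eq, hc₂.under_eq]
       congr 2
       · apply hout; simp [triangleMid, h₁, h₂, h₃, h₁', h₂', h₃']
       · apply hin
         simp [triangleMid, Equiv.symm_apply_eq, hu, hv, h₁, h₂, h₃, h₁', h₂', h₃'])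
    | (rw [← hc₁.over_eq, ← hc₂.over_eq]
       apply hin
       simp [triangleMid, Equiv.symm_apply_eq, hu, hv, h₁, h₂, h₃, h₁', h₂', h₃'])
  have hbot : c₁ (D.outEdge (tb, false)) = c₂ (D.outEdge (tb, false)) ∧
      c₁ (D.outEdge (mb, false)) = c₂ (D.outEdge (mb, false)) := by
    rcases h.middle with ⟨rfl, hu⟩ | ⟨rfl, hu⟩ <;> rcases h.bottom with ⟨rfl, hv⟩ | ⟨rfl, hv⟩ <;>
    refine ⟨?_, ?_⟩ <;>
    first
    | (apply hout; simp [triangleMid, h₁, h₂, h₃, h₁', h₂', h₃']; done)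
    | (rw [hc₁.under_eq, hc₂.under_eq]
       congr 2
       · first
         | exact hmid.2
         | (apply hout; simp [triangleMid, h₁, h₂, h₃, h₁', h₂', h₃'])
       · apply hin
         simp [triangleMid, Equiv.symm_apply_eq, hu, hv, h₁, h₂, h₃, h₁', h₂', h₃'])
  funext e
  rcases e with p | i
  · by_cases hm : p ∈ triangleMid tm tb mb u v
    · simp only [triangleMid, Set.mem_insert_iff, Set.mem_singleton_iff] at hm
      rcases hm with hm | hm <;> split_ifs at hm <;> subst hm
      exacts [hmid.1, hmid.2, hbot.1, hbot.2]
    · exact hp p hm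
  · exact hi i

theorem units_eq_of_one_eq_mul {a b : ℤˣ} (h : (1 : ℤˣ) = a * b) : b = a := by
  rw [← Int.units_inv_eq_self a]
  exact eq_inv_of_mul_eq_one_right h.symm

theorem signedAct_comm (σ δ : ℤˣ) (x y z : Q) :
    signedAct σ x (signedAct δ y z) =
      signedAct δ (signedAct σ x y) (signedAct σ x z) := by
  rw [signedAct_signedAct]; simp

/-- Self-distributivity with one action undone, for triangles with opposite orders `u` and `v`. -/
theorem signedAct_neg_comm (σ δ : ℤˣ) (x y z : Q) :
    signedAct (-σ) x (signedAct δ (signedAct σ x y) z) =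
      signedAct δ y (signedAct (-σ) x z) := by
  rw [signedAct_signedAct, signedAct_neg]; simp

-- The inner edges of the middle and bottom strands get the colors forced by the crossings in their
-- new order. That the bottom strand still leaves with its old color is self-distributivity. By
-- `sign_eq`, the signs of `tm` and `tb` agree exactly when `u = v`, and this makes distributivity
-- applicable in each of the four cases.
set_option linter.unusedSimpArgs false in
theorem IsTriangle.exists_coloring (h : D.IsTriangle tm tb mb w u v)
    (hs : IsTriangleSwap tm tb mb s) (hn : ∀ p, n (s p) = s (D.next p)) {c : D.Edge → Q}
    (hc : D.IsColoring c) : ∃ c' : (D.withNext n).Edge → Q, (D.withNext n).IsColoring c' ∧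
      (∀ p ∉ triangleMid tm tb mb u v, c (Sum.inl p) = c' (Sum.inl (s p))) ∧
      ∀ i, c (Sum.inr i) = c' (Sum.inr i) := by
  classical
  have h₁ := h.ne₁
  have h₂ := h.ne₂
  have h₃ := h.ne₃
  have h₁' := h.ne₁.symm
  have h₂' := h.ne₂.symm
  have h₃' := h.ne₃.symm
  have hinv : ∀ p, s (n.symm p) = D.next.symm (s p) := fun p => by
    rw [Equiv.eq_symm_apply]
    apply s.injective
    rw [← hn, hs.involutive, Equiv.apply_symm_apply, hs.involutive]
  -- it suffices to color the positions on the strands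
  suffices H : ∃ g gin : D.X × Bool → Q, (∀ p, g (D.next.symm p) = gin p) ∧
      (∀ p ∉ triangleMid tm tb mb u v, c (Sum.inl p) = g p) ∧
      (∀ k, gin (s (k, true)) = g (s (k, true))) ∧
      ∀ k, g (s (k, false)) = signedAct (D.sign k) (g (s (k, true))) (gin (s (k, false))) by
    -- `g p` and `gin p` are the colors that leave and reach the position which `p` occupied before
    -- the move. After the move this position carries the passage `s p`.
    obtain ⟨g, gin, hgin, hg, hg₁, hg₂⟩ := H
    refine ⟨Sum.elim (fun p => g (s p)) (fun i => c (Sum.inr i)),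
      ⟨fun (k : D.X) => ?_, fun (k : D.X) => ?_⟩,
      fun p hp => ?_, fun i => rfl⟩
    · change g (s (n.symm (k, true))) = g (s (k, true))
      rw [hinv, hgin, hg₁]
    · change g (s (k, false)) = signedAct (D.sign k) (g (s (k, true))) (g (s (n.symm (k, false))))
      rw [hinv, hgin, hg₂]
    · change _ = g (s (s p))
      rw [hg p hp, hs.involutive]
  have hover : ∀ k, c (Sum.inl (D.next.symm (k, true))) = c (Sum.inl (k, true)) := hc.over_eq
  have hunder : ∀ k, c (Sum.inl (k, false)) = signedAct (D.sign k) (c (Sum.inl (k, true)))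
    (c (Sum.inl (D.next.symm (k, false)))) := hc.under_eq
  have htop : c (Sum.inl (tb, true)) = c (Sum.inl (tm, true)) := by
    rcases h.top with ⟨-, hw⟩ | ⟨-, hw⟩
    · rw [← hover, ← hw, Equiv.symm_apply_apply]
    · rw [← hover tm, ← hw, Equiv.symm_apply_apply]
  -- the coloring is changed at two positions `m`, `b`
  have key : ∀ (m b m' b' : D.X × Bool) (M B : Q), D.next m = m' → D.next b = b' →
      ∃ g gin : D.X × Bool → Q, (∀ p, g (D.next.symm p) = gin p) ∧
        (∀ p, g p = if p = m then M else if p = b then B else c (Sum.inl p)) ∧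
        ∀ p, gin p = if p = m' then M else if p = b' then B else
          c (Sum.inl (D.next.symm p)) := by
    rintro m b _ _ M B rfl rfl
    exact ⟨fun p => if p = m then M else if p = b then B else c (Sum.inl p),
      fun p => if p = D.next m then M else if p = D.next b then B else
        c (Sum.inl (D.next.symm p)),
      fun p => by simp only [Equiv.symm_apply_eq], fun p => rfl, fun p => rfl⟩
  have hall : ∀ (P : D.X → Prop), P tm → P tb → P mb →
      (∀ k, k ≠ tm → k ≠ tb → k ≠ mb → P k) → ∀ k, P k := by
    intro P a₁ a₂ a₃ a₄ k
    by_cases k₁ : k = tm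
    · exact k₁ ▸ a₁
    by_cases k₂ : k = tb
    · exact k₂ ▸ a₂
    by_cases k₃ : k = mb
    · exact k₃ ▸ a₃
    exact a₄ k k₁ k₂ k₃
  have hneg : (-1 : ℤˣ) ≠ 1 := by decide
  have hsig := h.sign_eq
  have htm := hunder tm
  have htb := hunder tb
  have hmb := hunder mb
  have hmb' := hover mb
  rw [htop] at htb
  clear hn hinv
  rcases h.middle with ⟨rfl, hu⟩ | ⟨rfl, hu⟩ <;> rcases h.bottom with ⟨rfl, hv⟩ | ⟨rfl, hv⟩
  · have hσ : D.sign tb = D.sign tm := units_eq_of_one_eq_mul (by simpa using hsig)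
    have hm : D.next.symm (mb, true) = (tm, false) := by rw [← hu, Equiv.symm_apply_apply]
    have hb : D.next.symm (mb, false) = (tb, false) := by rw [← hv, Equiv.symm_apply_apply]
    -- After the move both lower strands meet `mb` first. The middle strand passes over there and
    -- keeps its incoming color; the bottom strand is acted on by that color.
    obtain ⟨g, gin, hgin, hg, hg'⟩ := key (tm, false) (tb, false) (mb, true) (mb, false)
      (c (Sum.inl (D.next.symm (tm, false))))
      (signedAct (D.sign mb)
        (c (Sum.inl (D.next.symm (tm, false)))) (c (Sum.inl (D.next.symm (tb, false))))) hu hv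
    refine ⟨g, gin, hgin, fun p hp => ?_, hall _ ?_ ?_ ?_ ?_, hall _ ?_ ?_ ?_ ?_⟩
    · simp only [triangleMid, reduceCtorEq, if_true, if_false, hneg, Set.mem_insert_iff,
        Set.mem_singleton_iff, not_or] at hp
      rw [hg, if_neg hp.1, if_neg hp.2]
    · simp [hs.tm_true, hg, hg', hover, h₂, h₃]
    · simp [hs.tb_true, hg, hg', hover, h₂, h₃]
    · simp [hs.mb_true, hg, hg', h₁, h₂, h₃, h₁', h₂', h₃']
    · intro k k₁ k₂ k₃
      simp [hs.of_ne, hg, hg', hover, k₁, k₂, k₃]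
    · simp only [hs.tm_true, hs.tm_false, hg, hg']
      simp [h₁, h₂, h₃, h₁', h₂', h₃', htop]
      rw [← hmb', hm, htm]
    · simp only [hs.tb_true, hs.tb_false, hg, hg']
      simp [h₁, h₂, h₃, h₁', h₂', h₃', htop]
      rw [hmb, hb, ← hmb', hm, htm, htb, hσ, ← signedAct_comm]
    · simp only [hs.mb_true, hs.mb_false, hg, hg']
      simp [h₁, h₂, h₃, h₁', h₂', h₃', htop]
    · intro k k₁ k₂ k₃
      simp only [hs.of_ne _ _ k₁ k₂ k₃, hg, hg']
      simp [k₁, k₂, k₃, ← hunder]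
  · have hσ : D.sign tb = -D.sign tm := by
      rw [← units_eq_of_one_eq_mul (a := D.sign tm) (b := -D.sign tb)
        (by rw [mul_neg]; simpa [neg_eq_iff_eq_neg] using hsig), neg_neg]
    have hm : D.next.symm (mb, true) = (tm, false) := by rw [← hu, Equiv.symm_apply_apply]
    have hb : D.next.symm (tb, false) = (mb, false) := by rw [← hv, Equiv.symm_apply_apply]
    -- Now the bottom strand meets `tb` first and is acted on by the top color.
    obtain ⟨g, gin, hgin, hg, hg'⟩ := key (tm, false) (mb, false) (mb, true) (tb, false)
      (c (Sum.inl (D.next.symm (tm, false))))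
      (signedAct (D.sign tb) (c (Sum.inl (tm, true))) (c (Sum.inl (D.next.symm (mb, false))))) hu hv
    refine ⟨g, gin, hgin, fun p hp => ?_, hall _ ?_ ?_ ?_ ?_, hall _ ?_ ?_ ?_ ?_⟩
    · simp only [triangleMid, reduceCtorEq, if_true, if_false, hneg, Set.mem_insert_iff,
        Set.mem_singleton_iff, not_or] at hp
      rw [hg, if_neg hp.1, if_neg hp.2]
    · simp [hs.tm_true, hg, hg', hover, h₂, h₃]
    · simp [hs.tb_true, hg, hg', hover, h₂, h₃]
    · simp [hs.mb_true, hg, hg', h₁, h₂, h₃, h₁', h₂', h₃']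
    · intro k k₁ k₂ k₃
      simp [hs.of_ne, hg, hg', hover, k₁, k₂, k₃]
    · simp only [hs.tm_true, hs.tm_false, hg, hg']
      simp [h₁, h₂, h₃, h₁', h₂', h₃', htop]
      rw [← hmb', hm, htm]
    · simp only [hs.tb_true, hs.tb_false, hg, hg']
      simp [h₁, h₂, h₃, h₁', h₂', h₃', htop]
    · simp only [hs.mb_true, hs.mb_false, hg, hg']
      simp [h₁, h₂, h₃, h₁', h₂', h₃', htop]
      rw [htb, hb, hmb, ← hmb', hm, htm, hσ, signedAct_neg_comm]
    · intro k k₁ k₂ k₃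
      simp only [hs.of_ne _ _ k₁ k₂ k₃, hg, hg']
      simp [k₁, k₂, k₃, ← hunder]
  · have hσ : D.sign tb = -D.sign tm := by
      rw [← units_eq_of_one_eq_mul (a := D.sign tm) (b := -D.sign tb)
        (by rw [mul_neg]; simpa [neg_eq_iff_eq_neg] using hsig), neg_neg]
    have hm : D.next.symm (tm, false) = (mb, true) := by rw [← hu, Equiv.symm_apply_apply]
    have hb : D.next.symm (mb, false) = (tb, false) := by rw [← hv, Equiv.symm_apply_apply]
    -- Now the middle strand meets `tm` first, so its inner edge already has the color with which
    -- the strand leaves the triangle.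
    obtain ⟨g, gin, hgin, hg, hg'⟩ := key (mb, true) (tb, false) (tm, false) (mb, false)
      (c (Sum.inl (tm, false)))
      (signedAct (D.sign mb) (c (Sum.inl (tm, false)))
        (c (Sum.inl (D.next.symm (tb, false))))) hu hv
    refine ⟨g, gin, hgin, fun p hp => ?_, hall _ ?_ ?_ ?_ ?_, hall _ ?_ ?_ ?_ ?_⟩
    · simp only [triangleMid, reduceCtorEq, if_true, if_false, hneg, Set.mem_insert_iff,
        Set.mem_singleton_iff, not_or] at hp
      rw [hg, if_neg hp.1, if_neg hp.2]
    · simp [hs.tm_true, hg, hg', hover, h₂, h₃]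
    · simp [hs.tb_true, hg, hg', hover, h₂, h₃]
    · simp [hs.mb_true, hg, hg', h₁, h₂, h₃, h₁', h₂', h₃']
    · intro k k₁ k₂ k₃
      simp [hs.of_ne, hg, hg', hover, k₁, k₂, k₃]
    · simp only [hs.tm_true, hs.tm_false, hg, hg']
      simp [h₁, h₂, h₃, h₁', h₂', h₃', htop]
      rw [htm, hm, hmb']
    · simp only [hs.tb_true, hs.tb_false, hg, hg']
      simp [h₁, h₂, h₃, h₁', h₂', h₃', htop]
      rw [hmb, hb, htb, htm, hm, hσ, signedAct_neg_comm]
    · simp only [hs.mb_true, hs.mb_false, hg, hg']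
      simp [h₁, h₂, h₃, h₁', h₂', h₃', htop]
    · intro k k₁ k₂ k₃
      simp only [hs.of_ne _ _ k₁ k₂ k₃, hg, hg']
      simp [k₁, k₂, k₃, ← hunder]
  · have hσ : D.sign tb = D.sign tm := units_eq_of_one_eq_mul (by simpa using hsig)
    have hm : D.next.symm (tm, false) = (mb, true) := by rw [← hu, Equiv.symm_apply_apply]
    have hb : D.next.symm (tb, false) = (mb, false) := by rw [← hv, Equiv.symm_apply_apply]
    obtain ⟨g, gin, hgin, hg, hg'⟩ := key (mb, true) (mb, false) (tm, false) (tb, false)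
      (c (Sum.inl (tm, false)))
      (signedAct (D.sign tb) (c (Sum.inl (tm, true))) (c (Sum.inl (D.next.symm (mb, false))))) hu hv
    refine ⟨g, gin, hgin, fun p hp => ?_, hall _ ?_ ?_ ?_ ?_, hall _ ?_ ?_ ?_ ?_⟩
    · simp only [triangleMid, reduceCtorEq, if_true, if_false, hneg, Set.mem_insert_iff,
        Set.mem_singleton_iff, not_or] at hp
      rw [hg, if_neg hp.1, if_neg hp.2]
    · simp [hs.tm_true, hg, hg', hover, h₂, h₃]
    · simp [hs.tb_true, hg, hg', hover, h₂, h₃]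
    · simp [hs.mb_true, hg, hg', h₁, h₂, h₃, h₁', h₂', h₃']
    · intro k k₁ k₂ k₃
      simp [hs.of_ne, hg, hg', hover, k₁, k₂, k₃]
    · simp only [hs.tm_true, hs.tm_false, hg, hg']
      simp [h₁, h₂, h₃, h₁', h₂', h₃', htop]
      rw [htm, hm, hmb']
    · simp only [hs.tb_true, hs.tb_false, hg, hg']
      simp [h₁, h₂, h₃, h₁', h₂', h₃', htop]
    · simp only [hs.mb_true, hs.mb_false, hg, hg']
      simp [h₁, h₂, h₃, h₁', h₂', h₃', htop]
      rw [htb, hb, hmb, htm, hm, hσ, signedAct_comm]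
    · intro k k₁ k₂ k₃
      simp only [hs.of_ne _ _ k₁ k₂ k₃, hg, hg']
      simp [k₁, k₂, k₃, ← hunder]

end Triangle

theorem isTriangleSwap_swap {X : Type} [DecidableEq X] {tm tb mb : X} (h₁ : tm ≠ tb)
    (h₂ : tm ≠ mb) (h₃ : tb ≠ mb) :
    IsTriangleSwap tm tb mb (Equiv.swap (tm, true) (tb, true) * Equiv.swap (tm, false) (mb, true) *
      Equiv.swap (tb, false) (mb, false)) := by
  have h₁' := h₁.symm
  have h₂' := h₂.symm
  have h₃' := h₃.symm
  have a₁ : ∀ k b, k ≠ tm → k ≠ tb → k ≠ mb →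
    (Equiv.swap (tm, true) (tb, true) * Equiv.swap (tm, false) (mb, true) *
      Equiv.swap (tb, false) (mb, false)) (k, b) = (k, b) := by
    intro k b k₁ k₂ k₃
    simp [Equiv.swap_apply_def, *]
  refine ⟨?_, ?_, ?_, ?_, ?_, ?_, ?_, a₁⟩
  · rintro ⟨k, b⟩
    by_cases k₁ : k = tm
    · cases b <;> simp [Equiv.swap_apply_def, *]
    by_cases k₂ : k = tb
    · cases b <;> simp [Equiv.swap_apply_def, *]
    by_cases k₃ : k = mb
    · cases b <;> simp [Equiv.swap_apply_def, *]
    rw [a₁ k b k₁ k₂ k₃, a₁ k b k₁ k₂ k₃]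
  all_goals simp [Equiv.swap_apply_def, *]

/-- The new diagram contains the triangle with all three orders reversed, so the same existence and
uniqueness lemmas serve for the converse direction. -/
theorem IsTriangle.biOrderable_iff {D : GaussDiagram} {tm tb mb : D.X} {w u v : ℤˣ}
    {s n : Equiv.Perm (D.X × Bool)} (h : D.IsTriangle tm tb mb w u v)
    (hs : IsTriangleSwap tm tb mb s) (hn : ∀ p, n (s p) = s (D.next p)) :
    BiOrderableQuandle D.LinkQuandle ↔ BiOrderableQuandle (D.withNext n).LinkQuandle := by
  have hn' : ∀ p, D.next (s p) = s (n p) := fun p => by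
    apply s.injective
    rw [← hn, hs.involutive, hs.involutive]
  have hmid : ∀ p, s p ∈ triangleMid tm tb mb (-u) (-v) ↔ p ∈ triangleMid tm tb mb u v := by
    have hsp : ∀ p q, s p = q ↔ p = s q := fun p q =>
      ⟨fun h => by rw [← h, hs.involutive], fun h => by rw [h, hs.involutive]⟩
    intro p
    rcases Int.units_eq_one_or u with rfl | rfl <;> rcases Int.units_eq_one_or v with rfl | rfl <;>
      simp [triangleMid, hsp, hs.tm_false, hs.mb_true, hs.tb_false, hs.mb_false]
  refine biOrderable_iff_of_colorings (D' := D.withNext n)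
    (fun e e' => (∃ p ∉ triangleMid tm tb mb u v, e = Sum.inl p ∧ e' = Sum.inl (s p)) ∨
      ∃ i, e = Sum.inr i ∧ e' = Sum.inr i) ?_ ?_ ?_ ?_
  · intro Q _ c hc
    obtain ⟨c', hc', h₁, h₂⟩ := h.exists_coloring hs hn hc
    refine ⟨c', hc', ?_⟩
    rintro e e' (⟨p, hp, rfl, rfl⟩ | ⟨i, rfl, rfl⟩)
    exacts [h₁ p hp, h₂ i]
  · intro Q _ c' hc'
    obtain ⟨c, hc, h₁, h₂⟩ := (h.flip hs hn).exists_coloring (D := D.withNext n) (n := D.next) hs hn' hc'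
    refine ⟨c, hc, ?_⟩
    rintro e e' (⟨p, hp, rfl, rfl⟩ | ⟨i, rfl, rfl⟩)
    · have := h₁ (s p) (fun h => hp ((hmid p).mp h))
      rw [hs.involutive] at this
      exact this.symm
    · exact (h₂ i).symm
  · intro Q _ c₁ c₂ hc₁ hc₂ h12
    refine (h.flip hs hn).coloring_ext hc₁ hc₂ (fun (p : D.X × Bool) hp => ?_)
      fun i => h12 _ _ (Or.inr ⟨i, rfl, rfl⟩)
    refine h12 (Sum.inl (s p)) _ (Or.inl ⟨s p, fun h => hp ?_, rfl, ?_⟩)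
    · rwa [← hmid, hs.involutive] at h
    · rw [hs.involutive]
  · intro Q _ c₁ c₂ hc₁ hc₂ h12
    exact h.coloring_ext hc₁ hc₂ (fun p hp => h12 _ _ (Or.inl ⟨p, hp, rfl, rfl⟩))
      fun i => h12 _ _ (Or.inr ⟨i, rfl, rfl⟩)

theorem R3.biOrderable_iff {D D' : GaussDiagram} (h : D.R3 D') :
    BiOrderableQuandle D.LinkQuandle ↔ BiOrderableQuandle D'.LinkQuandle := by
  classical
  obtain ⟨tm, tb, mb, σ, h₁, h₂, h₃, htop, hmiddle, hbottom, hiso⟩ := h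
  refine Iff.trans ?_ hiso.biOrderable_iff
  refine IsTriangle.biOrderable_iff (D := D) (s := Equiv.swap (tm, true) (tb, true) *
    Equiv.swap (tm, false) (mb, true) * Equiv.swap (tb, false) (mb, false))
    ⟨h₁, h₂, h₃, ?_, htop, hmiddle, hbottom⟩ (isTriangleSwap_swap h₁ h₂ h₃) fun p => ?_
  · rw [mul_assoc σ (D.sign mb), mul_comm (D.sign mb)]
  · generalize Equiv.swap (tm, true) (tb, true) * Equiv.swap (tm, false) (mb, true) *
      Equiv.swap (tb, false) (mb, false) = S
    simp

end GaussDiagram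

theorem LinkDiagram.Move.biOrderable_iff {D D' : LinkDiagram} (h : D.Move D') :
    BiOrderableQuandle D.LinkQuandle ↔ BiOrderableQuandle D'.LinkQuandle := by
  rcases h with h | h | h | h
  exacts [h.biOrderable_iff, h.biOrderable_iff, h.biOrderable_iff, h.biOrderable_iff]

/-- Bi-orderability of the link quandle does not depend on the diagram. -/
theorem LinkDiagram.biOrderable_iff_of_link_eq {D D' : LinkDiagram} (h : D.link = D'.link) :
    BiOrderableQuandle D.LinkQuandle ↔ BiOrderableQuandle D'.LinkQuandle := by
  replace h := Quot.eqvGen_exact h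
  induction h with
  | rel _ _ h => exact h.biOrderable_iff
  | refl => exact Iff.rfl
  | symm _ _ _ ih => exact ih.symm
  | trans _ _ _ _ _ ih ih' => exact ih.trans ih'

/-! ## Linking numbers -/

namespace GaussDiagram

section Linking

variable {D : GaussDiagram} {S : Set (D.X × Bool)}

open Classical in
/-- The direction of an edge of the sublink `S` met by the sweep line, and `0` for other edges. -/
noncomputable def insideWeight (S : Set (D.X × Bool)) (x : D.Edge × Bool) : ℤ :=
  if x.1 ∈ Sum.inl '' S then (if x.2 then 1 else -1) else 0

open Classical in
/-- The direction of an edge outside the sublink `S`, and `0` for the edges of `S`. -/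
noncomputable def outsideWeight (S : Set (D.X × Bool)) (x : D.Edge × Bool) : ℤ :=
  if x.1 ∈ Sum.inl '' S then 0 else (if x.2 then 1 else -1)

/-- The signed number of pairs of edges on the sweep line whose left member belongs to the sublink `S`
and whose right member does not. -/
noncomputable def pairCount (S : Set (D.X × Bool)) : List (D.Edge × Bool) → ℤ
  | [] => 0
  | x :: l => insideWeight S x * (l.map (outsideWeight S)).sum + pairCount S l

theorem pairCount_append (l m : List (D.Edge × Bool)) : pairCount S (l ++ m) =
    pairCount S l + pairCount S m +
      (l.map (insideWeight S)).sum * (m.map (outsideWeight S)).sum := by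
  induction l with
  | nil => simp [pairCount]
  | cons x l ih =>
    simp only [List.cons_append, pairCount, ih, List.map_append, List.sum_append, List.map_cons,
      List.sum_cons]
    ring

open Classical in
/-- The change of `pairCount` at a crossing. -/
noncomputable def crossingChange (S : Set (D.X × Bool)) (c : D.X) : ℤ :=
  (if D.rightPassage c ∈ S ∧ D.leftPassage c ∉ S then 1 else 0) -
    (if D.leftPassage c ∈ S ∧ D.rightPassage c ∉ S then 1 else 0)

-- At an extremum the two pieces of one edge have opposite weights and cancel. At a crossing two
-- upward strands change places, which matters only if exactly one of them is in `S`. Once the line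
-- is empty again, this says that the crossings of `S` over its complement and those under it give
-- the same linking number.
open Classical in
theorem pairCount_eq_sum_crossingChange (hS : ∀ p, D.next p ∈ S ↔ p ∈ S)
    {l : List (D.Edge × Bool)} {cs : List D.X} (h : D.Draws l cs) :
    pairCount S l = (cs.map (crossingChange S)).sum := by
  have hpair : ∀ (u v : List (D.Edge × Bool)) (e : D.Edge) (b : Bool),
      pairCount S (u ++ (e, b) :: (e, !b) :: v) = pairCount S (u ++ v) := by
    intro u v e b
    have h₁ : insideWeight S (e, !b) = -insideWeight S (e, b) := by
      by_cases he : e ∈ Sum.inl '' S <;> cases b <;> simp only [insideWeight, he] <;> simp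
    have h₂ : outsideWeight S (e, !b) = -outsideWeight S (e, b) := by
      by_cases he : e ∈ Sum.inl '' S <;> cases b <;> simp only [outsideWeight, he] <;> simp
    have h₃ : insideWeight S (e, b) * outsideWeight S (e, b) = 0 := by
      by_cases he : e ∈ Sum.inl '' S <;> simp only [insideWeight, outsideWeight, he, if_true,
        if_false, mul_zero, zero_mul]
    simp only [pairCount_append, pairCount, List.map_cons, List.sum_cons, h₁, h₂]
    linear_combination -h₃
  have hin : ∀ p, D.inEdge p ∈ Sum.inl '' S ↔ p ∈ S := by
    intro p
    rw [inEdge, Sum.inl_injective.mem_set_image, ← hS, Equiv.apply_symm_apply]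
  have hout : ∀ p, D.outEdge p ∈ Sum.inl '' S ↔ p ∈ S := by
    intro p
    rw [outEdge, Sum.inl_injective.mem_set_image]
  have hin₁ : ∀ p, insideWeight S (D.inEdge p, true) = if p ∈ S then 1 else 0 := fun p => by
    by_cases hp : p ∈ S
    · rw [insideWeight, if_pos ((hin p).mpr hp), if_pos hp]; rfl
    · rw [insideWeight, if_neg (mt (hin p).mp hp), if_neg hp]
  have hin₂ : ∀ p, outsideWeight S (D.inEdge p, true) = if p ∈ S then 0 else 1 := fun p => by
    by_cases hp : p ∈ S
    · rw [outsideWeight, if_pos ((hin p).mpr hp), if_pos hp]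
    · rw [outsideWeight, if_neg (mt (hin p).mp hp), if_neg hp]; rfl
  have hout₁ : ∀ p, insideWeight S (D.outEdge p, true) = if p ∈ S then 1 else 0 := fun p => by
    by_cases hp : p ∈ S
    · rw [insideWeight, if_pos ((hout p).mpr hp), if_pos hp]; rfl
    · rw [insideWeight, if_neg (mt (hout p).mp hp), if_neg hp]
  have hout₂ : ∀ p, outsideWeight S (D.outEdge p, true) = if p ∈ S then 0 else 1 := fun p => by
    by_cases hp : p ∈ S
    · rw [outsideWeight, if_pos ((hout p).mpr hp), if_pos hp]
    · rw [outsideWeight, if_neg (mt (hout p).mp hp), if_neg hp]; rfl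
  induction h with
  | empty => rfl
  | minimum u v cs e b _ ih => rw [hpair, ih]
  | maximum u v cs e b _ ih => rw [← hpair u v e b, ih]
  | crossing u v cs c _ _ ih =>
    rw [List.map_cons, List.sum_cons, ← ih]
    simp only [pairCount_append, pairCount, List.map_cons, List.sum_cons, hin₁, hin₂, hout₁,
      hout₂, crossingChange]
    by_cases h₁ : D.leftPassage c ∈ S <;> by_cases h₂ : D.rightPassage c ∈ S <;>
      simp [h₁, h₂] <;> ring

theorem eq_zero_of_sum_eq_zero {α : Type} {r : α → ℤ} {l : List α} (h₀ : ∀ a, 0 ≤ r a)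
    (h : (l.map r).sum = 0) : ∀ a ∈ l, r a = 0 := by
  induction l with
  | nil => simp
  | cons x l ih =>
    have h₁ : 0 ≤ (l.map r).sum := List.sum_nonneg (by simp [h₀])
    have h₂ := h₀ x
    rw [List.map_cons, List.sum_cons] at h
    intro a ha
    rcases List.mem_cons.mp ha with rfl | ha
    · omega
    · exact ih (by omega) a ha

/-- In a planar diagram all of whose crossings have the same sign, a sublink that passes nowhere
under its complement passes nowhere over it either. -/
theorem under_mem_of_over_mem (hD : D.Planar) {ε : ℤˣ} (hε : ∀ c, D.sign c = ε)
    (hS : ∀ p, D.next p ∈ S ↔ p ∈ S) (h : ∀ c, (c, false) ∈ S → (c, true) ∈ S) (c : D.X)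
    (hc : (c, true) ∈ S) : (c, false) ∈ S := by
  obtain ⟨cs, hcs, hall⟩ := hD
  have hsum := pairCount_eq_sum_crossingChange hS hcs
  simp only [pairCount] at hsum
  by_contra hcf
  -- By `h` only crossings of `S` over its complement contribute. Their contributions have one sign
  -- and sum to zero, so all of them vanish.
  rcases Int.units_eq_one_or ε with rfl | rfl
  · have hl : ∀ a, D.leftPassage a = (a, true) := fun a => by simp [leftPassage, hε]
    have hr : ∀ a, D.rightPassage a = (a, false) := fun a => by simp [rightPassage, hε]
    have h₀ : ∀ a, 0 ≤ -crossingChange S a := fun a => by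
      have hneg : ¬ ((a, false) ∈ S ∧ (a, true) ∉ S) := fun h' => h'.2 (h a h'.1)
      rw [crossingChange, hl, hr, if_neg hneg]
      split_ifs <;> simp
    have h₁ : (cs.map fun a => -crossingChange S a).sum = 0 := by
      rw [← neg_zero, hsum, List.sum_neg, List.map_map]
      rfl
    have := eq_zero_of_sum_eq_zero h₀ h₁ c (hall c)
    simp [crossingChange, hl, hr, hc, hcf] at this
  · have hl : ∀ a, D.leftPassage a = (a, false) := fun a => by simp [leftPassage, hε]
    have hr : ∀ a, D.rightPassage a = (a, true) := fun a => by simp [rightPassage, hε]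
    have h₀ : ∀ a, 0 ≤ crossingChange S a := fun a => by
      have hneg : ¬ ((a, false) ∈ S ∧ (a, true) ∉ S) := fun h' => h'.2 (h a h'.1)
      rw [crossingChange, hl, hr, if_neg hneg]
      split_ifs <;> simp
    have := eq_zero_of_sum_eq_zero h₀ hsum.symm c (hall c)
    simp [crossingChange, hl, hr, hc, hcf] at this

end Linking

/-! ## Following the arcs of a diagram -/

section Arcs

variable {D : GaussDiagram}

theorem next_mem_sameCycle_iff (p₀ p : D.X × Bool) :
    D.next p ∈ {p | D.next.SameCycle p₀ p} ↔ p ∈ {p | D.next.SameCycle p₀ p} := by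
  simp

theorem arc_next {p : D.X × Bool} (h : (D.next p).2 = true) :
    D.arc (Sum.inl (D.next p)) = D.arc (Sum.inl p) := by
  refine (Quot.sound ⟨(D.next p).1, ?_, ?_⟩).symm
  · rw [← h, inEdge, Equiv.symm_apply_apply]
  · rw [← h, outEdge]

/-- On a walk that begins at an under-passage, the latest under-passage starts the current arc. -/
theorem exists_under_start {k : D.X} {p : D.X × Bool} (h : D.next.SameCycle (k, false) p) :
    ∃ k', D.arc (D.outEdge (k', false)) = D.arc (Sum.inl p) := by
  have := D.finite
  obtain ⟨n, rfl⟩ := h.exists_nat_pow_eq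
  clear h
  induction n with
  | zero => exact ⟨k, rfl⟩
  | succ n ih =>
    rw [pow_succ', Equiv.Perm.mul_apply]
    cases hb : (D.next ((D.next ^ n) (k, false))).2 with
    | true => rw [arc_next hb]; exact ih
    | false =>
      refine ⟨(D.next ((D.next ^ n) (k, false))).1, congrArg (fun p => D.arc (Sum.inl p)) ?_⟩
      exact Prod.ext rfl hb.symm

/-- The walk from `p` returns to `(k, false)`; the first under-passage after `p` ends the arc. -/
theorem exists_under_end {k : D.X} {p : D.X × Bool} (h : D.next.SameCycle (k, false) p) :
    ∃ k', D.arc (D.inEdge (k', false)) = D.arc (Sum.inl p) := by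
  have := D.finite
  have h' : D.next.SameCycle p (D.next.symm (k, false)) := by
    have := h.symm
    nth_rewrite 1 [← D.next.apply_symm_apply (k, false)] at this
    simpa using this
  obtain ⟨n, hn⟩ := h'.exists_nat_pow_eq
  replace hn : (D.next ^ (n + 1)) p = (k, false) := by
    rw [pow_succ', Equiv.Perm.mul_apply, hn, Equiv.apply_symm_apply]
  clear h'
  clear h
  induction n generalizing p with
  | zero =>
    refine ⟨k, ?_⟩
    rw [← hn, inEdge, zero_add, pow_one, Equiv.symm_apply_apply]
  | succ n ih =>
    cases hb : (D.next p).2 with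
    | true =>
      rw [← arc_next hb]
      exact ih (by rw [pow_succ, Equiv.Perm.mul_apply] at hn; exact hn)
    | false => exact ⟨(D.next p).1, by
      rw [← hb, inEdge, Equiv.symm_apply_apply]⟩

/-- The passage `(k, false)` is the first under-passage that is met from the passage `r` on. -/
def FirstUnder (D : GaussDiagram) (k : D.X) (r : D.X × Bool) : Prop :=
  ∃ n : ℕ, (D.next ^ n) r = (k, false) ∧ ∀ j < n, ((D.next ^ j) r).2 = true

theorem firstUnder_self (k : D.X) : D.FirstUnder k (k, false) := ⟨0, rfl, by simp⟩

theorem FirstUnder.eq_of_false {k k' : D.X} (h : D.FirstUnder k (k', false)) : k' = k := by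
  obtain ⟨n, hn, hj⟩ := h
  cases n with
  | zero => exact congrArg Prod.fst hn
  | succ n => simpa using hj 0 (by omega)

theorem firstUnder_true_iff (k c : D.X) :
    D.FirstUnder k (c, true) ↔ D.FirstUnder k (D.next (c, true)) := by
  constructor
  · rintro ⟨n, hn, hj⟩
    cases n with
    | zero => simp at hn
    | succ n =>
      refine ⟨n, by rw [pow_succ, Equiv.Perm.mul_apply] at hn; exact hn, fun j hjn => ?_⟩
      have := hj (j + 1) (by omega)
      rwa [pow_succ, Equiv.Perm.mul_apply] at this
  · rintro ⟨n, hn, hj⟩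
    refine ⟨n + 1, by rw [pow_succ, Equiv.Perm.mul_apply, hn], fun j hjn => ?_⟩
    cases j with
    | zero => rfl
    | succ j =>
      rw [pow_succ, Equiv.Perm.mul_apply]
      exact hj j (by omega)

theorem FirstUnder.sameCycle {k : D.X} {r : D.X × Bool} (h : D.FirstUnder k r) :
    D.next.SameCycle (k, false) r := by
  obtain ⟨n, hn, -⟩ := h
  exact Equiv.Perm.SameCycle.symm ⟨n, by simpa using hn⟩

/-- Going through an over-passage does not change which under-passage comes next, so this is a
property of arcs. -/
theorem firstUnder_next_iff_of_arc_eq {k : D.X} {p q : D.X × Bool}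
    (h : D.arc (Sum.inl p) = D.arc (Sum.inl q)) :
    D.FirstUnder k (D.next p) ↔ D.FirstUnder k (D.next q) := by
  let P : D.Arc → Prop := Quot.lift
    (Sum.elim (fun p => D.FirstUnder k (D.next p)) fun _ => False) (by
      rintro _ _ ⟨c, rfl, rfl⟩
      simp only [inEdge, outEdge, Sum.elim_inl, Equiv.apply_symm_apply]
      exact propext (firstUnder_true_iff k c))
  exact iff_of_eq (congrArg P h)

/-- If the three arcs at a crossing `k` of a planar diagram with crossings of one sign coincide, then
`k` is the only crossing on its component. -/
theorem next_eq_of_arcs_eq (hD : D.Planar) {ε : ℤˣ} (hε : ∀ c, D.sign c = ε) {k : D.X}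
    (h₁ : D.arc (D.outEdge (k, false)) = D.arc (D.inEdge (k, false)))
    (h₂ : D.arc (D.outEdge (k, true)) = D.arc (D.inEdge (k, false))) (b : Bool) :
    D.next (k, b) = (k, !b) := by
  have := D.finite
  have hself : D.FirstUnder k (D.next (D.next.symm (k, false))) := by
    rw [Equiv.apply_symm_apply]; exact firstUnder_self k
  -- The arc that leaves `(k, false)` ends at `(k, false)`, so the component has no other
  -- under-passage. The over-arc at `k` ends there too, so `(k, true)` lies on the same component.
  have hf : D.FirstUnder k (D.next (k, false)) := (firstUnder_next_iff_of_arc_eq h₁).mpr hself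
  have ht : D.FirstUnder k (D.next (k, true)) := (firstUnder_next_iff_of_arc_eq h₂).mpr hself
  have hcyc : ∀ p, D.next.SameCycle (k, false) p → D.FirstUnder k p := by
    intro p hp
    obtain ⟨n, rfl⟩ := hp.exists_nat_pow_eq
    clear hp
    induction n with
    | zero => exact firstUnder_self k
    | succ n ih =>
      rw [pow_succ', Equiv.Perm.mul_apply]
      generalize (D.next ^ n) (k, false) = r at ih
      obtain ⟨c, b⟩ := r
      cases b with
      | true => exact (firstUnder_true_iff k c).mp ih
      | false => rw [ih.eq_of_false]; exact hf
  have hkt : D.next.SameCycle (k, false) (k, true) := by simpa using ht.sameCycle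
  have hmem : ∀ p, D.next.SameCycle (k, false) p → p.1 = k := by
    rintro ⟨c, b⟩ hp
    cases b with
    | false => exact (hcyc _ hp).eq_of_false
    | true =>
      -- The only under-passage of the component lies below the component itself. So it passes
      -- nowhere under its complement, hence nowhere over it.
      refine (hcyc _ (under_mem_of_over_mem hD hε (next_mem_sameCycle_iff (k, false))
        (fun c hc => ?_) c hp)).eq_of_false
      rw [(hcyc _ hc).eq_of_false]
      exact hkt
  have hfalse : D.next (k, false) = (k, true) := by
    have h₃ : (D.next (k, false)).1 = k :=
      hmem _ (by simp [Equiv.Perm.SameCycle.refl])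
    cases hb : (D.next (k, false)).2 with
    | true => exact Prod.ext h₃ hb
    | false =>
      have hfix : D.next (k, false) = (k, false) := Prod.ext h₃ hb
      have := hkt.eq_of_left hfix
      simp at this
  cases b with
  | false => exact hfalse
  | true =>
    have h₃ : (D.next (k, true)).1 = k := hmem _ (by simpa using hkt)
    cases hb : (D.next (k, true)).2 with
    | false => exact Prod.ext h₃ hb
    | true =>
      have h₄ : D.next (k, true) = (k, true) := Prod.ext h₃ hb
      have := D.next.injective (h₄.trans hfalse.symm)
      simp at this

end Arcs

end GaussDiagram

/-! ## Erasing a component with a single crossing -/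

namespace GaussDiagram

section EraseKink

variable (D : GaussDiagram) (k : D.X)

theorem next_fst_ne (hk : ∀ b, D.next (k, b) = (k, !b)) {p : D.X × Bool} (hp : p.1 ≠ k) :
    (D.next p).1 ≠ k := by
  intro h
  have h₁ : D.next p = D.next (k, !(D.next p).2) := by
    rw [hk, Bool.not_not]; exact Prod.ext h rfl
  exact hp (congrArg Prod.fst (D.next.injective h₁))

theorem next_symm_eq (hk : ∀ b, D.next (k, b) = (k, !b)) (b : Bool) : D.next.symm (k, b) = (k, !b) := by
  rw [Equiv.symm_apply_eq, hk, Bool.not_not]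

theorem next_symm_fst_ne (hk : ∀ b, D.next (k, b) = (k, !b)) {p : D.X × Bool}
    (hp : p.1 ≠ k) : (D.next.symm p).1 ≠ k := by
  intro h
  have h₁ : D.next.symm p = D.next.symm (k, !(D.next.symm p).2) := by
    rw [next_symm_eq D k hk, Bool.not_not]; exact Prod.ext h rfl
  exact hp (congrArg Prod.fst (D.next.symm.injective h₁))

variable (hk : ∀ b, D.next (k, b) = (k, !b))

/-- The diagram without the component that consists of the kink `k`, which is replaced by a component
without crossings. -/
noncomputable def eraseKink : GaussDiagram where
  X := {c : D.X // c ≠ k}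
  finite := by
    have := D.finite
    infer_instance
  sign c := D.sign c.1
  next :=
    { toFun := fun p => (⟨(D.next (p.1.1, p.2)).1, next_fst_ne D k hk p.1.2⟩,
        (D.next (p.1.1, p.2)).2)
      invFun := fun p => (⟨(D.next.symm (p.1.1, p.2)).1, next_symm_fst_ne D k hk p.1.2⟩,
        (D.next.symm (p.1.1, p.2)).2)
      left_inv := fun p => by simp
      right_inv := fun p => by simp }
  loops := D.loops + Nat.card {s : Quotient (Equiv.Perm.SameCycle.setoid D.next) //
    ∀ p : D.X × Bool, Quotient.mk (Equiv.Perm.SameCycle.setoid D.next) p = s → p.1 ∈ ({k} : Set D.X)}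

theorem erases_eraseKink : D.Erases {k} (D.eraseKink k hk) := by
  refine ⟨Subtype.val, Subtype.val_injective, ?_, fun c => rfl, fun p => ⟨0, rfl, by simp⟩, rfl⟩
  exact Subtype.range_val

open Classical in
/-- The edge of the diagram without the kink, if there is one. -/
noncomputable def eraseKinkEdge : D.Edge → Option (D.eraseKink k hk).Edge
  | Sum.inl p => if h : p.1 ≠ k then some (Sum.inl (⟨p.1, h⟩, p.2)) else none
  -- Planarity only asks for a drawing of all crossings, so crossingless components may be left out.
  | Sum.inr _ => none

theorem eraseKinkEdge_of_eq {p : D.X × Bool} (hp : p.1 = k) :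
    D.eraseKinkEdge k hk (Sum.inl p) = none := by simp [eraseKinkEdge, hp]

theorem eraseKinkEdge_of_ne {p : D.X × Bool} (hp : p.1 ≠ k) :
    D.eraseKinkEdge k hk (Sum.inl p) = some (Sum.inl (⟨p.1, hp⟩, p.2)) := by
  simp [eraseKinkEdge, hp]

-- When the omitted edges are deleted from every sweep line, their extrema and the crossing `k` no
-- longer change the line, and all other events stay as they are.
open Classical in
theorem Draws.eraseKink {l : List (D.Edge × Bool)} {cs : List D.X} (h : D.Draws l cs) :
    (D.eraseKink k hk).Draws
      (l.filterMap fun x => (D.eraseKinkEdge k hk x.1).map fun e => (e, x.2))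
      (cs.filterMap fun c => if h : c ≠ k then some ⟨c, h⟩ else none) := by
  induction h with
  | empty => exact Draws.empty
  | minimum u v cs e b _ ih =>
    rw [List.filterMap_append] at ih ⊢
    cases he : D.eraseKinkEdge k hk e with
    | none => simpa [List.filterMap_cons, he] using ih
    | some e' => simpa [List.filterMap_cons, he] using Draws.minimum _ _ _ e' b ih
  | maximum u v cs e b _ ih =>
    rw [List.filterMap_append] at ih ⊢
    cases he : D.eraseKinkEdge k hk e with
    | none => simpa [List.filterMap_cons, he] using ih
    | some e' =>
      refine Draws.maximum _ _ _ e' b ?_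
      simpa [List.filterMap_cons, he] using ih
  | crossing u v cs c hc _ ih =>
    rw [List.filterMap_append] at ih ⊢
    by_cases hck : c = k
    · subst hck
      have hin : ∀ b, D.eraseKinkEdge c hk (D.inEdge (c, b)) = none := fun b =>
        eraseKinkEdge_of_eq D c hk (by rw [next_symm_eq D c hk])
      have hout : ∀ b, D.eraseKinkEdge c hk (D.outEdge (c, b)) = none := fun b =>
        eraseKinkEdge_of_eq D c hk rfl
      simpa [List.filterMap_cons, leftPassage, rightPassage, hin, hout] using ih
    · have hin : ∀ b, D.eraseKinkEdge k hk (D.inEdge (c, b)) =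
          some ((D.eraseKink k hk).inEdge (⟨c, hck⟩, b)) := fun b =>
        eraseKinkEdge_of_ne D k hk (next_symm_fst_ne D k hk hck)
      have hout : ∀ b, D.eraseKinkEdge k hk (D.outEdge (c, b)) =
          some ((D.eraseKink k hk).outEdge (⟨c, hck⟩, b)) := fun b =>
        eraseKinkEdge_of_ne D k hk hck
      have hcs : (⟨c, hck⟩ : {c : D.X // c ≠ k}) ∉
          cs.filterMap fun c => if h : c ≠ k then some (⟨c, h⟩ : {c : D.X // c ≠ k}) else none := by
        intro hm
        obtain ⟨a, ha, hac⟩ := List.mem_filterMap.mp hm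
        split_ifs at hac with h
        simp only [Option.some.injEq, Subtype.mk.injEq] at hac
        exact hc (hac ▸ ha)
      simp only [List.filterMap_cons, leftPassage, rightPassage, hin, hout, Option.map_some,
        dif_pos hck] at ih ⊢
      exact Draws.crossing (D := D.eraseKink k hk) _ _ _ ⟨c, hck⟩ hcs ih

theorem Planar.eraseKink (h : D.Planar) : (D.eraseKink k hk).Planar := by
  classical
  obtain ⟨cs, hcs, hall⟩ := h
  refine ⟨_, Draws.eraseKink D k hk hcs, fun c => ?_⟩
  refine List.mem_filterMap.mpr ⟨c.1, hall c.1, ?_⟩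
  rw [dif_pos c.2]
  rfl

end EraseKink

end GaussDiagram

/-! ## Minimal diagrams with distinct generators -/

/-- In a bi-ordered quandle, `x * y` is less than neither `x` nor `y` only if `x = y`. -/
theorem eq_of_act_le {Q : Type} [Quandle Q] [LinearOrder Q]
    (h₁ : ∀ x y z : Q, x < y → x ◃ z < y ◃ z) (h₂ : ∀ x y z : Q, x < y → z ◃ x < z ◃ y) {x y : Q}
    (hx : y ◃ x ≤ x) (hy : y ◃ x ≤ y) : x = y := by
  rcases lt_trichotomy x y with h | h | h
  -- If `x < y`, then `x = x * x < x * y`; if `y < x`, then `y = y * y < x * y`.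
  · have := h₁ _ _ x h
    rw [Quandle.fix] at this
    exact absurd hx (not_le.mpr this)
  · exact h
  · have := h₂ _ _ y h
    rw [Quandle.fix] at this
    exact absurd hy (not_le.mpr this)

namespace LinkDiagram

/-- The arc to minimize is the one that is a product of the other two: the outgoing under-arc for
positive, the incoming one for negative crossings. The other arcs at the minimal crossing start,
respectively end, at under-passages, so they take part in the comparison. -/
theorem exists_kink (D : LinkDiagram) {ε : ℤˣ} (hε : D.AllOfSign ε)
    (hgen : Function.Injective D.gen) (hQ : BiOrderableQuandle D.LinkQuandle) [Nonempty D.X] :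
    ∃ k : D.X, ∀ b, D.next (k, b) = (k, !b) := by
  have := D.finite
  obtain ⟨o, hl, hr⟩ := hQ
  -- A component without under-passages passes nowhere under its complement, so it passes nowhere
  -- over it either. But the strand below `(k, true)` would not belong to it.
  have hunder : ∀ k : D.X, ∃ k', D.next.SameCycle (k', false) (k, true) := by
    intro k
    by_contra! hno
    refine hno k (Equiv.Perm.SameCycle.symm ?_)
    refine GaussDiagram.under_mem_of_over_mem (S := {p | D.next.SameCycle (k, true) p}) D.planar hε
      (GaussDiagram.next_mem_sameCycle_iff (k, true)) (fun c hc => ?_) k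
      (Equiv.Perm.SameCycle.refl _ _)
    exact absurd (Equiv.Perm.SameCycle.symm hc) (hno c)
  have hin : ∀ k : D.X, D.next.SameCycle (k, false) (D.next.symm (k, false)) := fun k =>
    ⟨-1, by simp⟩
  have hcol := D.isColoring_edgeGen
  have hinj : ∀ {e e' : D.Edge}, D.edgeGen e = D.edgeGen e' → D.arc e = D.arc e' :=
    fun h => hgen h
  rcases Int.units_eq_one_or ε with rfl | rfl
  · obtain ⟨k, hk⟩ := Finite.exists_min fun k : D.X => D.edgeGen (D.outEdge (k, false))
    obtain ⟨k₁, hk₁⟩ := GaussDiagram.exists_under_start (hin k)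
    obtain ⟨k₂, hk₂⟩ := GaussDiagram.exists_under_start (hunder k).choose_spec
    have hrel := hcol.under_eq k
    rw [hε k, signedAct_one] at hrel
    have hx : D.edgeGen (D.outEdge (k, false)) ≤ D.edgeGen (D.inEdge (k, false)) :=
      (hk k₁).trans_eq (congrArg D.gen hk₁)
    have hy : D.edgeGen (D.outEdge (k, false)) ≤ D.edgeGen (D.outEdge (k, true)) :=
      (hk k₂).trans_eq (congrArg D.gen hk₂)
    have hxy := eq_of_act_le hl hr (hrel ▸ hx) (hrel ▸ hy)
    refine ⟨k, GaussDiagram.next_eq_of_arcs_eq D.planar hε (hinj ?_) (hinj hxy.symm)⟩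
    rw [hrel, hxy, Quandle.fix]
  · obtain ⟨k, hk⟩ := Finite.exists_min fun k : D.X => D.edgeGen (D.inEdge (k, false))
    obtain ⟨k₁, hk₁⟩ := GaussDiagram.exists_under_end (Equiv.Perm.SameCycle.refl D.next (k, false))
    obtain ⟨k₂, hk₂⟩ := GaussDiagram.exists_under_end (hunder k).choose_spec
    have hrel := hcol.under_eq k
    rw [hε k, signedAct_neg_one] at hrel
    replace hrel : D.edgeGen (D.inEdge (k, false)) =
        D.edgeGen (D.outEdge (k, true)) ◃ D.edgeGen (D.outEdge (k, false)) := by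
      rw [hrel, Rack.right_inv]
    have hx : D.edgeGen (D.inEdge (k, false)) ≤ D.edgeGen (D.outEdge (k, false)) :=
      (hk k₁).trans_eq (congrArg D.gen hk₁)
    have hy : D.edgeGen (D.inEdge (k, false)) ≤ D.edgeGen (D.outEdge (k, true)) :=
      (hk k₂).trans_eq (congrArg D.gen hk₂)
    have hxy := eq_of_act_le hl hr (hrel ▸ hx) (hrel ▸ hy)
    refine ⟨k, GaussDiagram.next_eq_of_arcs_eq D.planar hε (hinj ?_) (hinj ?_)⟩
    · rw [hrel, hxy, Quandle.fix]
    · rw [hrel, hxy, Quandle.fix]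

end LinkDiagram

/-- The first Reidemeister move removes the kink and leaves a diagram of the same link and sign with
fewer crossings. -/
theorem Link.IsMinimalDiagramOfSign.not_biOrderable {L : Link} {ε : ℤˣ} {D : LinkDiagram}
    (hD : L.IsMinimalDiagramOfSign ε D) (hL : ¬ L.IsTrivial) (hgen : Function.Injective D.gen) :
    ¬ BiOrderableQuandle D.LinkQuandle := by
  intro hQ
  obtain ⟨hlink, hε, hmin⟩ := hD
  have hX : Nonempty D.X := by
    by_contra hX
    exact hL ⟨D, hlink, not_nonempty_iff.mp hX⟩
  obtain ⟨k, hk⟩ := D.exists_kink hε hgen hQ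
  let D' : LinkDiagram := ⟨D.eraseKink k hk, GaussDiagram.Planar.eraseKink _ k hk D.planar⟩
  have hmove : D.Move D' :=
    LinkDiagram.Move.r1 ⟨k, true, hk true, D.toGaussDiagram.erases_eraseKink k hk⟩
  have hle := hmin D' ((Quot.sound hmove).symm.trans hlink) fun c => hε c.1
  have := D.finite
  have hlt : Nat.card {c : D.X // c ≠ k} < Nat.card D.X :=
    Finite.card_subtype_lt (x := k) (by simp)
  exact absurd hle (not_le.mpr hlt)

/-! ## The two ends of a cut edge act in the same way -/

namespace GaussDiagram

section Cut

variable {D : GaussDiagram} {Q : Type} [Quandle Q]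

/-- The product, from left to right, of the actions of the edges on the sweep line. -/
def sweepProduct (c : D.Edge → Q) (l : List (D.Edge × Bool)) : Equiv.Perm Q :=
  (l.map fun x => if x.2 then Rack.act' (c x.1) else (Rack.act' (c x.1))⁻¹).prod

theorem sweepProduct_append (c : D.Edge → Q) (l m : List (D.Edge × Bool)) :
    sweepProduct c (l ++ m) = sweepProduct c l * sweepProduct c m := by
  simp [sweepProduct]

theorem sweepProduct_cons (c : D.Edge → Q) (x : D.Edge × Bool) (l : List (D.Edge × Bool)) :
    sweepProduct c (x :: l) =
      (if x.2 then Rack.act' (c x.1) else (Rack.act' (c x.1))⁻¹) * sweepProduct c l := by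
  simp [sweepProduct]

theorem sweepProduct_pair (c : D.Edge → Q) (u v : List (D.Edge × Bool)) (e : D.Edge) (b : Bool) :
    sweepProduct c (u ++ (e, b) :: (e, !b) :: v) = sweepProduct c (u ++ v) := by
  simp only [sweepProduct_append, sweepProduct_cons]
  cases b <;> simp

/-- Colors `s`, `t` are assigned to the starts and ends of the edges. They agree except on the edge
that starts at `p`. Then in a planar diagram the two colors of this edge act in the same way. -/
theorem act'_eq_of_cut (hD : D.Planar) (s t : D.Edge → Q) (p : D.X × Bool)
    (hst : ∀ e, e ≠ D.outEdge p → s e = t e)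
    (hover : ∀ k, t (D.inEdge (k, true)) = s (D.outEdge (k, true)))
    (hunder : ∀ k, s (D.outEdge (k, false)) =
      signedAct (D.sign k) (s (D.outEdge (k, true))) (t (D.inEdge (k, false)))) :
    Rack.act' (s (D.outEdge p)) = Rack.act' (t (D.outEdge p)) := by
  have hcross : ∀ k, Rack.act' (t (D.inEdge (D.leftPassage k))) *
      Rack.act' (t (D.inEdge (D.rightPassage k))) =
      Rack.act' (s (D.outEdge (D.rightPassage k))) *
        Rack.act' (s (D.outEdge (D.leftPassage k))) := by
    intro k
    have h₁ := hover k
    have h₂ := hunder k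
    rcases Int.units_eq_one_or (D.sign k) with h | h
    · simp only [leftPassage, rightPassage, h, decide_true, Bool.not_true]
      rw [h₂, act'_signedAct, h, h₁]
      simp [signedAct]
    · simp only [leftPassage, rightPassage, h, show ¬ ((-1 : ℤˣ) = 1) by decide, decide_false,
        Bool.not_false]
      rw [h₂, act'_signedAct, h, h₁]
      simp [signedAct, mul_assoc]
  -- The sweep line is labelled by `t`. Its product stays trivial up to the crossing where the cut
  -- edge starts. There `t` replaces `s` on that edge, and from then on the product is a conjugate
  -- of the defect.
  have key : ∀ {l cs}, D.Draws l cs → (p.1 ∉ cs → sweepProduct t l = 1) ∧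
      (p.1 ∈ cs → ∃ g, sweepProduct t l =
        g * (Rack.act' (t (D.outEdge p)) * (Rack.act' (s (D.outEdge p)))⁻¹) * g⁻¹) := by
    intro l cs h
    induction h with
    | empty => exact ⟨fun _ => rfl, fun h => absurd h (by simp)⟩
    | minimum u v cs e b _ ih => rwa [sweepProduct_pair]
    | maximum u v cs e b _ ih => rwa [sweepProduct_pair] at ih
    | crossing u v cs k hk _ ih =>
      simp only [sweepProduct_append, sweepProduct_cons, if_true] at ih ⊢
      rw [← mul_assoc (Rack.act' (t (D.inEdge _))), hcross] at ih
      by_cases hpk : p.1 = k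
      · refine ⟨fun h => absurd (by simp [hpk]) h, fun _ => ?_⟩
        have h₁ := ih.1 (hpk ▸ hk)
        by_cases hpr : p = D.rightPassage k
        · have hl : t (D.outEdge (D.leftPassage k)) = s (D.outEdge (D.leftPassage k)) := by
            refine (hst _ fun h => ?_).symm
            have := (Sum.inl.inj h).trans hpr
            simp [leftPassage, rightPassage] at this
          rw [hl, ← hpr]
          rw [← hpr] at h₁
          refine ⟨sweepProduct t u, ?_⟩
          rw [← mul_one (_ * (sweepProduct t u)⁻¹), ← h₁]
          group
        · have hpl : p = D.leftPassage k := by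
            obtain ⟨a, b⟩ := p
            obtain rfl : a = k := hpk
            simp only [leftPassage, rightPassage, Prod.mk.injEq, true_and] at hpr ⊢
            cases b <;> simp_all
          have hr : t (D.outEdge (D.rightPassage k)) = s (D.outEdge (D.rightPassage k)) :=
            (hst _ fun h => hpr (Sum.inl.inj h).symm).symm
          rw [hr, ← hpl]
          rw [← hpl] at h₁
          refine ⟨sweepProduct t u * Rack.act' (s (D.outEdge (D.rightPassage k))), ?_⟩
          rw [← mul_one (_ * (sweepProduct t u * _)⁻¹), ← h₁]
          group
      · have hs : ∀ q : D.X × Bool, q.1 = k → t (D.outEdge q) = s (D.outEdge q) :=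
          fun q hq => (hst _ fun h => hpk (by rw [← Sum.inl.inj h, hq])).symm
        rw [hs _ rfl, hs _ rfl, ← mul_assoc (Rack.act' (s (D.outEdge (D.rightPassage k))))]
        simpa [hpk] using ih
  -- The final sweep line is empty, so the defect is trivial.
  obtain ⟨cs, hcs, hall⟩ := hD
  obtain ⟨g, hg⟩ := (key hcs).2 (hall _)
  have h₁ : (1 : Equiv.Perm Q) =
      g * (Rack.act' (t (D.outEdge p)) * (Rack.act' (s (D.outEdge p)))⁻¹) * g⁻¹ := hg
  rw [eq_comm, conj_eq_one_iff, mul_inv_eq_one] at h₁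
  exact h₁.symm

end Cut

/-! ## Connected sums -/

/-- Bi-orderability passes to the link quandle of `D₂` if its tautological coloring factors through
colorings of `D` and by the link quandle of `D`. -/
theorem biOrderable_of_retract {D D₂ : GaussDiagram} (c : D₂.Edge → D.LinkQuandle)
    (hc : D₂.IsColoring c) (α : D₂.Edge → D.Edge) (hα : ∀ e, c e = D.edgeGen (α e))
    (r : D.Edge → D₂.LinkQuandle) (hr : D.IsColoring r) (hrα : ∀ e, r (α e) = D₂.edgeGen e)
    (h : BiOrderableQuandle D.LinkQuandle) : BiOrderableQuandle D₂.LinkQuandle := by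
  obtain ⟨φ, hφ⟩ := hc.exists_hom
  obtain ⟨ψ, hψ⟩ := hr.exists_hom
  refine h.of_injective φ (Function.LeftInverse.injective (g := ψ) fun x => ?_)
  refine linkQuandle_hom_ext (φ := ψ.comp φ) (ψ := ShelfHom.id _) (fun e => ?_) x
  rw [ShelfHom.comp_apply, hφ, hα, hψ, hrα]
  rfl

section Sum

variable (D₁ D₂ : GaussDiagram)

theorem sumNext_inl (q : D₁.X × Bool) :
    sumNext D₁ D₂ (onPassages Sum.inl q) = onPassages Sum.inl (D₁.next q) := rfl

theorem sumNext_inr (q : D₂.X × Bool) :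
    sumNext D₁ D₂ (onPassages Sum.inr q) = onPassages Sum.inr (D₂.next q) := rfl

theorem sumNext_symm_inl (q : D₁.X × Bool) :
    (sumNext D₁ D₂).symm (onPassages Sum.inl q) = onPassages Sum.inl (D₁.next.symm q) := by
  rw [Equiv.symm_apply_eq, sumNext_inl, Equiv.apply_symm_apply]

theorem sumNext_symm_inr (q : D₂.X × Bool) :
    (sumNext D₁ D₂).symm (onPassages Sum.inr q) = onPassages Sum.inr (D₂.next.symm q) := by
  rw [Equiv.symm_apply_eq, sumNext_inr, Equiv.apply_symm_apply]

/-- A diagram on the crossings of `D₁` and `D₂`. -/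
abbrev sumDiagram (n : Equiv.Perm ((D₁.X ⊕ D₂.X) × Bool)) (N : ℕ) : GaussDiagram where
  X := D₁.X ⊕ D₂.X
  finite := by
    have := D₁.finite
    have := D₂.finite
    infer_instance
  sign := Sum.elim D₁.sign D₂.sign
  next := n
  loops := N

/-- The coloring that collapses `D₁` to the edge `e` of `D₂`. -/
def collapse {D₁ D₂ : GaussDiagram} (e : D₂.Edge) (p : (D₁.X ⊕ D₂.X) × Bool) : D₂.LinkQuandle :=
  Sum.elim (fun _ => D₂.edgeGen e) (fun x => D₂.edgeGen (Sum.inl (x, p.2))) p.1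

variable {D₁ D₂} {n : Equiv.Perm ((D₁.X ⊕ D₂.X) × Bool)} {N : ℕ}

/-- Within `D₁` a single color occurs, so the relations hold by idempotency; within `D₂` the
coloring is the tautological one. -/
theorem isColoring_collapse (e : D₂.Edge) (f : Fin N → D₂.LinkQuandle)
    (h₁ : ∀ q : D₁.X × Bool, collapse e (n.symm (onPassages Sum.inl q)) = D₂.edgeGen e)
    (h₂ : ∀ q : D₂.X × Bool,
      collapse e (n.symm (onPassages Sum.inr q)) = D₂.edgeGen (D₂.inEdge q)) :
    (sumDiagram D₁ D₂ n N).IsColoring (Sum.elim (collapse e) f) := by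
  constructor
  · rintro (x | x)
    · exact h₁ (x, true)
    · exact (h₂ (x, true)).trans (D₂.isColoring_edgeGen.over_eq x)
  · rintro (x | x)
    · change D₂.edgeGen e = signedAct (D₁.sign x) (D₂.edgeGen e)
        (collapse e (n.symm (onPassages Sum.inl (x, false))))
      rw [h₁, signedAct_self]
    · change D₂.edgeGen (D₂.outEdge (x, false)) = signedAct (D₂.sign x)
        (D₂.edgeGen (D₂.outEdge (x, true))) (collapse e (n.symm (onPassages Sum.inr (x, false))))
      rw [h₂]
      exact D₂.isColoring_edgeGen.under_eq x

theorem isColoring_restrict (c : D₂.Edge → (sumDiagram D₁ D₂ n N).LinkQuandle)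
    (hout : ∀ q : D₂.X × Bool,
      c (D₂.outEdge q) = (sumDiagram D₁ D₂ n N).edgeGen (Sum.inl (onPassages Sum.inr q)))
    (hin : ∀ q : D₂.X × Bool,
      c (D₂.inEdge q) = (sumDiagram D₁ D₂ n N).edgeGen (Sum.inl (n.symm (onPassages Sum.inr q)))) :
    D₂.IsColoring c := by
  have h := (sumDiagram D₁ D₂ n N).isColoring_edgeGen
  constructor
  · intro k
    rw [hout, hin]
    exact h.over_eq (Sum.inr k)
  · intro k
    rw [hout, hout, hin]
    exact h.under_eq (Sum.inr k)

/-- No edge with crossings is cut here. The edge `a j` stands in for the crossingless component `j`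
of `D₂`. -/
theorem biOrderable_of_sumDiagram_sumNext (e : D₂.Edge) (f : Fin N → D₂.LinkQuandle)
    (a : Fin D₂.loops → (sumDiagram D₁ D₂ (sumNext D₁ D₂) N).Edge)
    (ha : ∀ j, Sum.elim (collapse e) f (a j) = D₂.edgeGen (Sum.inr j))
    (h : BiOrderableQuandle (sumDiagram D₁ D₂ (sumNext D₁ D₂) N).LinkQuandle) :
    BiOrderableQuandle D₂.LinkQuandle := by
  let D := sumDiagram D₁ D₂ (sumNext D₁ D₂) N
  let α : D₂.Edge → D.Edge := Sum.elim (fun q => Sum.inl (onPassages Sum.inr q)) a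
  refine biOrderable_of_retract (D := D) (fun x => D.edgeGen (α x))
    (isColoring_restrict _ (fun q => rfl) fun q => ?_) α (fun _ => rfl)
    (Sum.elim (collapse e) f) (isColoring_collapse e f (fun q => ?_) fun q => ?_) ?_ h
  · rw [sumNext_symm_inr]
    rfl
  · rw [sumNext_symm_inl]
    rfl
  · rw [sumNext_symm_inr]
    rfl
  · rintro (q | j)
    · rfl
    · exact ha j

theorem biOrderable_of_connectedSum {e₁ : D₁.Edge} {e₂ : D₂.Edge} (hD₂ : D₂.Planar)
    (h : BiOrderableQuandle (D₁.connectedSum D₂ e₁ e₂).LinkQuandle) :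
    BiOrderableQuandle D₂.LinkQuandle := by
  classical
  rcases e₁ with p₁ | i₁
  · rcases e₂ with p₂ | j₂
    · let n := sumNext D₁ D₂ * Equiv.swap (onPassages Sum.inl p₁) (onPassages Sum.inr p₂)
      let D := sumDiagram D₁ D₂ n (D₁.loops + D₂.loops)
      replace h : BiOrderableQuandle D.LinkQuandle := h
      have hn : ∀ x, n.symm x = Equiv.swap (onPassages Sum.inl p₁) (onPassages Sum.inr p₂)
          ((sumNext D₁ D₂).symm x) := fun x => by
        rw [Equiv.symm_apply_eq, Equiv.Perm.mul_apply, Equiv.swap_apply_self,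
          Equiv.apply_symm_apply]
      have hne : ∀ (q₁ : D₁.X × Bool) (q₂ : D₂.X × Bool),
          (onPassages Sum.inl q₁ : (D₁.X ⊕ D₂.X) × Bool) ≠ onPassages Sum.inr q₂ := by
        intro q₁ q₂ h
        cases congrArg Prod.fst h
      have hn₁ : ∀ q, n.symm (onPassages Sum.inl q) = onPassages Sum.inr p₂ ∨
          n.symm (onPassages Sum.inl q) = onPassages Sum.inl (D₁.next.symm q) := by
        intro q
        rw [hn, sumNext_symm_inl]
        by_cases hq : D₁.next.symm q = p₁
        · exact Or.inl (by rw [hq, Equiv.swap_apply_left])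
        · refine Or.inr (Equiv.swap_apply_of_ne_of_ne (fun h => hq ?_) (hne _ _))
          exact Prod.ext (Sum.inl_injective (congrArg Prod.fst h))
            (congrArg (fun x : (D₁.X ⊕ D₂.X) × Bool => x.2) h)
      have hn₂ : ∀ q, (D₂.next.symm q = p₂ ∧
          n.symm (onPassages Sum.inr q) = onPassages Sum.inl p₁) ∨ (D₂.next.symm q ≠ p₂ ∧
          n.symm (onPassages Sum.inr q) = onPassages Sum.inr (D₂.next.symm q)) := by
        intro q
        rw [hn, sumNext_symm_inr]
        by_cases hq : D₂.next.symm q = p₂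
        · exact Or.inl ⟨hq, by rw [hq, Equiv.swap_apply_right]⟩
        · refine Or.inr ⟨hq, Equiv.swap_apply_of_ne_of_ne (hne _ _).symm (fun h => hq ?_)⟩
          exact Prod.ext (Sum.inr_injective (congrArg Prod.fst h))
            (congrArg (fun x : (D₁.X ⊕ D₂.X) × Bool => x.2) h)
      let α : D₂.Edge → D.Edge := Sum.elim (fun q => Sum.inl (onPassages Sum.inr q))
        (fun j => Sum.inr (Fin.natAdd D₁.loops j))
      -- In the sum, the edge `p₂` of `D₂` begins as the edge from `p₂` and ends as the edge from
      -- `p₁`. Planarity of `D₂` makes these two colors act equally, and bi-orderability makes them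
      -- equal.
      have hcut : D.edgeGen (α (Sum.inl p₂)) = D.edgeGen (Sum.inl (onPassages Sum.inl p₁)) := by
        let t : D₂.Edge → D.LinkQuandle := Function.update (fun x => D.edgeGen (α x)) (Sum.inl p₂)
          (D.edgeGen (Sum.inl (onPassages Sum.inl p₁)))
        have ht : t (Sum.inl p₂) = D.edgeGen (Sum.inl (onPassages Sum.inl p₁)) :=
          Function.update_self _ _ _
        have hin : ∀ q, t (D₂.inEdge q) = D.edgeGen (D.inEdge (onPassages Sum.inr q)) := by
          intro q
          change t (Sum.inl (D₂.next.symm q)) =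
            D.edgeGen (Sum.inl (n.symm (onPassages Sum.inr q)))
          rcases hn₂ q with ⟨h₁, h₂⟩ | ⟨h₁, h₂⟩
          · rw [h₁, h₂]
            exact ht
          · rw [h₂]
            exact Function.update_of_ne (fun h => h₁ (Sum.inl.inj h)) _ _
        refine Eq.trans ?_ ht
        refine h.eq_of_act'_eq (act'_eq_of_cut hD₂ (fun x => D.edgeGen (α x)) t p₂
          (fun e he => (Function.update_of_ne (f := fun x => D.edgeGen (α x)) he _).symm)
          (fun k => ?_) fun k => ?_)
        · rw [hin]
          exact D.isColoring_edgeGen.over_eq (Sum.inr k)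
        · rw [hin]
          exact D.isColoring_edgeGen.under_eq (Sum.inr k)
      refine biOrderable_of_retract (D := D) (fun x => D.edgeGen (α x))
        (isColoring_restrict _ (fun q => rfl) fun q => ?_) α (fun _ => rfl)
        (Sum.elim (collapse (Sum.inl p₂))
          (Fin.addCases (fun _ => D₂.edgeGen (Sum.inl p₂)) fun j => D₂.edgeGen (Sum.inr j)))
        (isColoring_collapse _ _ (fun q => ?_) fun q => ?_) ?_ h
      · change D.edgeGen (α (Sum.inl (D₂.next.symm q))) = _
        rcases hn₂ q with ⟨h₁, h₂⟩ | ⟨h₁, h₂⟩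
        · rw [h₁, h₂]
          exact hcut
        · rw [h₂]
          rfl
      · rcases hn₁ q with h₁ | h₁ <;> rw [h₁] <;> rfl
      · rcases hn₂ q with ⟨h₁, h₂⟩ | ⟨h₁, h₂⟩
        · rw [h₂, inEdge, h₁]
          rfl
        · rw [h₂]
          rfl
      · rintro (q | j)
        · rfl
        · exact Fin.addCases_right (motive := fun _ => D₂.LinkQuandle)
            (left := fun _ => D₂.edgeGen (Sum.inl p₂)) (right := fun j => D₂.edgeGen (Sum.inr j)) j
    -- The loop `j₂` is absorbed by the edge `p₁`, which represents it; `ι` places the other loops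
    -- of `D₂` among the loops of the sum.
    · have hcard : Fintype.card {j : Fin D₂.loops // j ≠ j₂} ≤
          Fintype.card (Fin (D₁.loops + D₂.loops - 1)) := by
        have := j₂.2
        simp only [ne_eq, Fintype.card_subtype_compl, Fintype.card_fin, Fintype.card_unique]
        omega
      obtain ⟨ι⟩ := Function.Embedding.nonempty_of_card_le hcard
      refine biOrderable_of_sumDiagram_sumNext (D₁ := D₁) (N := D₁.loops + D₂.loops - 1)
        (Sum.inr j₂) (Function.extend ι (fun j => D₂.edgeGen (Sum.inr j.1))
          fun _ => D₂.edgeGen (Sum.inr j₂))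
        (fun j => if hj : j ≠ j₂ then Sum.inr (ι ⟨j, hj⟩) else Sum.inl (onPassages Sum.inl p₁))
        (fun j => ?_) h
      by_cases hj : j = j₂
      · simp [hj, collapse, onPassages]
      · simp only [ne_eq, hj, not_false_eq_true, dite_true, Sum.elim_inr]
        exact ι.injective.extend_apply _ _ ⟨j, hj⟩
  -- `D₁` has the loop `i₁`, so after one loop is absorbed there is still room for all loops of
  -- `D₂`.
  · have hle : D₂.loops ≤ D₁.loops + D₂.loops - 1 := by
      have := i₁.2
      omega
    refine biOrderable_of_sumDiagram_sumNext (D₁ := D₁) (N := D₁.loops + D₂.loops - 1)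
      e₂ (Function.extend (Fin.castLE hle) (fun j => D₂.edgeGen (Sum.inr j))
        fun _ => D₂.edgeGen e₂) (fun j => Sum.inr (Fin.castLE hle j))
      (fun j => ?_) ?_
    · rw [Sum.elim_inr]
      exact (Fin.castLE_injective hle).extend_apply _ _ j
    · rcases e₂ with p₂ | j₂ <;> exact h

end Sum

end GaussDiagram

/-! ### The theorem -/

theorem theorem4p6 (ε : ℤˣ) (L₁ L₂ : Link) (hnontrivial : ¬ L₂.IsTrivial)
    (hsign : L₂.IsOfSign ε) (D₂ : LinkDiagram) (hD₂ : L₂.IsMinimalDiagramOfSign ε D₂)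
    (hdistinct : Function.Injective D₂.gen) :
    (∀ L : Link, L₁.IsConnectedSum L₂ L → ¬ L.HasBiOrderableQuandle) ∧
      ¬ L₂.HasBiOrderableQuandle := by
  have hmain : ¬ L₂.HasBiOrderableQuandle := by
    rintro ⟨D, hD, hQ⟩
    exact hD₂.not_biOrderable hnontrivial hdistinct
      ((LinkDiagram.biOrderable_iff_of_link_eq (hD.trans hD₂.1.symm)).mp hQ)
  refine ⟨?_, hmain⟩
  rintro L ⟨D₁, D₂', D, -, hlink₂, hlink, e₁, e₂, hiso⟩ ⟨D', hD', hQ⟩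
  -- The sum is formed with an arbitrary diagram `D₂'` of `L₂`, which suffices because the cutting
  -- argument needs only planarity.
  refine hmain ⟨D₂', hlink₂, GaussDiagram.biOrderable_of_connectedSum D₂'.planar
    (hiso.biOrderable_iff.mpr ?_)⟩
  exact (LinkDiagram.biOrderable_iff_of_link_eq (hD'.trans hlink.symm)).mp hQ
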